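/- Let $\lambda\in\mathbb R$, write $\langle x\rangle=\sqrt{1+x^2}$, and let $$L^2_\lambda(\mathbb R)=e^{\lambda\langle x\rangle}L^2(\mathbb R)=\Big\{f:\mathbb R\to\mathbb C \text{ measurable}:\ \|f\|_{L^2_\lambda}^2=\int_{\mathbb R}|f(x)|^2e^{-2\lambda\langle x\rangle}\,dx<\infty\Big\},$$ $$H^2_\lambda(\mathbb R)=\{u\in L^2_\lambda(\mathbb R):\ u',u''\in L^2_\lambda(\mathbb R)\}\quad\text{(weak derivatives)}.$$ A function $f:\mathbb R\to\mathbb R$ is called totally bounded if it is smooth and $f$ and all its derivatives are bounded. Let $a,b,c:\mathbb R\to\mathbb R$ be totally bounded and suppose that $T=a\,\partial_x^2+b\,\partial_x+c$ is uniformly strongly elliptic, i.e. its coefficients are bounded and there is $\epsilon>0$ with $a(x)\ge\epsilon$ for all $x\in\mathbb R$. Then the unbounded operator $T$ on $L^2_\lambda(\mathbb R)$ with domain $H^2_\lambda(\mathbb R)$, $Tu=au''+bu'+cu$, generates an analytic semigroup on $L^2_\lambda(\mathbb R)$. In particular, $B=\partial_x^2-\partial_x$ with domain $H^2_\lambda(\mathbb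 R)$ generates an analytic semigroup on $L^2_\lambda(\mathbb R)$. Here an operator $T$ with domain $D(T)$ is said to generate an analytic semigroup on a Banach space $X$ if there are $\delta\in(0,\pi/2]$ and a map $S:\Delta_\delta\cup\{0\}\to\mathcal L(X)$ into the bounded operators on $X$, where $\Delta_\delta=\{re^{i\theta}: r>0,\ -\delta<\theta<\delta\}$, such that: $S$ is analytic on $\Delta_\delta$; $S(z_1+z_2)=S(z_1)S(z_2)$ for all $z_1,z_2\in\Delta_\delta\cup\{0\}$; $S(0)=I$; $\lim_{z\to0,\,z\in\Delta_\delta}S(z)x=x$ for all $x\in X$; and $T$ is the generator of $S$, i.e. $D(T)$ is exactly the set of $x\in X$ for which $\lim_{t\searrow0}t^{-1}(S(t)x-x)$ exists, and $Tx$ is equal to this limit for $x\in D(T)$. -/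

import Mathlib

open MeasureTheory Filter Topology Set
open scoped ContDiff

noncomputable section

namespace WeightedSemigroup

/-! ### Analytic semigroups and their generators -/

section Semigroup

variable {X : Type*} [NormedAddCommGroup X] [NormedSpace ℂ X]

/-- The open sector `{r e^{iθ} : r > 0, -δ < θ < δ}` (for `δ ≤ π`). -/
def sector (δ : ℝ) : Set ℂ := {z | z ≠ 0 ∧ |z.arg| < δ}

/-- `S` restricted to `sector δ ∪ {0}` is an analytic semigroup of bounded operators on `X`.
The bound `δ ≤ π / 2` makes the sector closed under addition. The values of `S` outside of
`sector δ ∪ {0}` play no role. -/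
structure IsAnalyticSemigroup (δ : ℝ) (S : ℂ → X →L[ℂ] X) : Prop where
  pos : 0 < δ
  le_pi_div_two : δ ≤ Real.pi / 2
  analytic : AnalyticOnNhd ℂ S (sector δ)
  map_add : ∀ z₁ ∈ sector δ ∪ {0}, ∀ z₂ ∈ sector δ ∪ {0}, S (z₁ + z₂) = S z₁ ∘L S z₂
  map_zero : S 0 = ContinuousLinearMap.id ℂ X
  tendsto_zero : ∀ x : X, Tendsto (fun z => S z x) (𝓝[sector δ] 0) (𝓝 x)

/-- The graph of the generator: the pairs `(x, y)` with `y = lim_{t ↘ 0} t⁻¹ (S(t) x - x)`. -/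
def generatorGraph (S : ℝ → X →L[ℂ] X) : Submodule ℂ (X × X) where
  carrier := {p | Tendsto (fun t : ℝ => ((t⁻¹ : ℝ) : ℂ) • (S t p.1 - p.1)) (𝓝[>] 0) (𝓝 p.2)}
  zero_mem' := by simp
  add_mem' := by
    intro p q hp hq
    refine (Tendsto.add hp hq).congr fun t => ?_
    simp only [Prod.fst_add, map_add]
    rw [← smul_add]
    congr 1
    abel
  smul_mem' := by
    intro c p hp
    refine (Tendsto.const_smul hp c).congr fun t => ?_
    simp only [Prod.smul_fst, map_smul]
    rw [smul_comm, smul_sub]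

/-- The generator of the one-parameter family `S`: its domain is the set of the `x` for which
`lim_{t ↘ 0} t⁻¹ (S(t) x - x)` exists, and its value at such an `x` is this limit. -/
def generator (S : ℝ → X →L[ℂ] X) : X →ₗ.[ℂ] X := (generatorGraph S).toLinearPMap

theorem mem_graph_generator (S : ℝ → X →L[ℂ] X) (x y : X) :
    (x, y) ∈ (generator S).graph ↔
      Tendsto (fun t : ℝ => ((t⁻¹ : ℝ) : ℂ) • (S t x - x)) (𝓝[>] 0) (𝓝 y) := by
  rw [generator, Submodule.toLinearPMap_graph_eq]
  · rfl
  · rintro ⟨x, y⟩ hp (rfl : x = 0)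
    refine tendsto_nhds_unique (f := fun _ : ℝ => (0 : X)) (l := 𝓝[>] (0 : ℝ)) ?_
      tendsto_const_nhds
    simpa [generatorGraph] using hp

/-- The (unbounded) operator `T` generates an analytic semigroup on `X`: it is, with its domain,
the generator of an analytic semigroup. -/
def GeneratesAnalyticSemigroup (T : X →ₗ.[ℂ] X) : Prop :=
  ∃ (δ : ℝ) (S : ℂ → X →L[ℂ] X),
    IsAnalyticSemigroup δ S ∧ generator (fun t : ℝ => S (t : ℂ)) = T

end Semigroup

/-! ### The weighted space `L²_lam(ℝ) = e^{lam⟨x⟩} L²(ℝ)` -/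

/-- The measure `e^{-2 lam ⟨x⟩} dx`, where `⟨x⟩ = √(1 + x²)`. -/
def weightMeasure (lam : ℝ) : Measure ℝ :=
  volume.withDensity fun x => ENNReal.ofReal (Real.exp (-2 * lam * √(1 + x ^ 2)))

/-- `L²_lam(ℝ) = e^{lam⟨x⟩} L²(ℝ)`, complex-valued, with `‖f‖² = ∫ |f|² e^{-2 lam ⟨x⟩} dx`. -/
abbrev WeightedL2 (lam : ℝ) : Type := Lp ℂ 2 (weightMeasure lam)

theorem continuous_weight (lam : ℝ) :
    Continuous fun x : ℝ => Real.exp (-2 * lam * √(1 + x ^ 2)) := by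
  fun_prop

instance isLocallyFiniteMeasure_weightMeasure (lam : ℝ) :
    IsLocallyFiniteMeasure (weightMeasure lam) :=
  IsLocallyFiniteMeasure.withDensity_ofReal (continuous_weight lam)

theorem volume_absolutelyContinuous_weightMeasure (lam : ℝ) :
    (volume : Measure ℝ) ≪ weightMeasure lam := by
  refine withDensity_absolutelyContinuous' (by fun_prop) (Eventually.of_forall fun x => ?_)
  simp [Real.exp_pos]

theorem weightMeasure_absolutelyContinuous_volume (lam : ℝ) :
    weightMeasure lam ≪ (volume : Measure ℝ) :=
  withDensity_absolutelyContinuous _ _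

theorem locallyIntegrable_weightedL2 {lam : ℝ} (u : WeightedL2 lam) :
    LocallyIntegrable u volume := by
  have h : LocallyIntegrable u (weightMeasure lam) :=
    (Lp.memLp u).locallyIntegrable (by norm_num)
  rw [locallyIntegrable_iff] at h ⊢
  intro K hK
  have h1 := h K hK
  have e : (weightMeasure lam).restrict K = (volume.restrict K).withDensity
      (fun x => ENNReal.ofReal (Real.exp (-2 * lam * √(1 + x ^ 2)))) :=
    restrict_withDensity hK.measurableSet _
  rw [IntegrableOn, e, integrable_withDensity_iff_integrable_smul' (by fun_prop)
      (Eventually.of_forall fun x => ENNReal.ofReal_lt_top)] at h1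
  have h2 := IntegrableOn.continuousOn_smul (K := K) h1
    (f := fun x : ℝ => (Real.exp (-2 * lam * √(1 + x ^ 2)))⁻¹)
    (((continuous_weight lam).inv₀ fun x => (Real.exp_pos _).ne').continuousOn) hK
  refine h2.congr (Eventually.of_forall fun x => ?_)
  simp only [ENNReal.toReal_ofReal (Real.exp_pos _).le]
  rw [smul_smul, inv_mul_cancel₀ (Real.exp_pos _).ne', one_smul]

/-! ### Weak derivatives and the weighted Sobolev space `H²_lam(ℝ)` -/

/-- `v` is the weak (distributional) derivative of `u`, where `u, v ∈ L²_lam(ℝ)`: for all test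
functions `φ ∈ C_c^∞(ℝ)` one has `∫ φ' u dx = - ∫ φ v dx` (both integrals exist since the elements
of `L²_lam(ℝ)` are locally integrable). -/
def IsWeakDeriv {lam : ℝ} (u v : WeightedL2 lam) : Prop :=
  ∀ φ : ℝ → ℝ, ContDiff ℝ ∞ φ → HasCompactSupport φ →
    ∫ x, deriv φ x • u x = - ∫ x, φ x • v x

theorem integrable_test_smul {lam : ℝ} (u : WeightedL2 lam) {φ : ℝ → ℝ}
    (hφ : ContDiff ℝ ∞ φ) (hc : HasCompactSupport φ) : Integrable (fun x => φ x • u x) :=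
  (locallyIntegrable_weightedL2 u).integrable_smul_left_of_hasCompactSupport hφ.continuous hc

theorem integrable_deriv_test_smul {lam : ℝ} (u : WeightedL2 lam) {φ : ℝ → ℝ}
    (hφ : ContDiff ℝ ∞ φ) (hc : HasCompactSupport φ) : Integrable (fun x => deriv φ x • u x) :=
  (locallyIntegrable_weightedL2 u).integrable_smul_left_of_hasCompactSupport
    (hφ.continuous_deriv (by simp)) hc.deriv

theorem integral_smul_add {lam : ℝ} (u v : WeightedL2 lam) {g : ℝ → ℝ}
    (hu : Integrable (fun x => g x • u x)) (hv : Integrable (fun x => g x • v x)) :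
    ∫ x, g x • (u + v : WeightedL2 lam) x = (∫ x, g x • u x) + ∫ x, g x • v x := by
  rw [← integral_add hu hv]
  refine integral_congr_ae ?_
  filter_upwards [(volume_absolutelyContinuous_weightMeasure lam).ae_eq (Lp.coeFn_add u v)]
    with x hx
  rw [hx, Pi.add_apply, smul_add]

theorem integral_smul_smul {lam : ℝ} (k : ℂ) (u : WeightedL2 lam) (g : ℝ → ℝ) :
    ∫ x, g x • (k • u : WeightedL2 lam) x = k • ∫ x, g x • u x := by
  rw [← integral_smul]
  refine integral_congr_ae ?_
  filter_upwards [(volume_absolutelyContinuous_weightMeasure lam).ae_eq (Lp.coeFn_smul k u)]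
    with x hx
  rw [hx, Pi.smul_apply, smul_comm]

theorem IsWeakDeriv.add {lam : ℝ} {u v u' v' : WeightedL2 lam} (hu : IsWeakDeriv u u')
    (hv : IsWeakDeriv v v') : IsWeakDeriv (u + v) (u' + v') := by
  intro φ hφ hc
  rw [integral_smul_add u v (integrable_deriv_test_smul u hφ hc)
      (integrable_deriv_test_smul v hφ hc),
    integral_smul_add u' v' (integrable_test_smul u' hφ hc) (integrable_test_smul v' hφ hc),
    hu φ hφ hc, hv φ hφ hc, neg_add]

theorem IsWeakDeriv.smul {lam : ℝ} (k : ℂ) {u u' : WeightedL2 lam} (hu : IsWeakDeriv u u') :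
    IsWeakDeriv (k • u) (k • u') := by
  intro φ hφ hc
  rw [integral_smul_smul, integral_smul_smul, hu φ hφ hc, smul_neg]

theorem isWeakDeriv_zero (lam : ℝ) : IsWeakDeriv (0 : WeightedL2 lam) 0 := by
  have h : ∀ g : ℝ → ℝ, ∫ x, g x • (0 : WeightedL2 lam) x = 0 := fun g => by
    simpa using integral_smul_smul (lam := lam) 0 0 g
  intro φ _ _
  rw [h, h, neg_zero]

/-- Weak derivatives are unique. -/
theorem IsWeakDeriv.unique {lam : ℝ} {u v w : WeightedL2 lam} (hv : IsWeakDeriv u v)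
    (hw : IsWeakDeriv u w) : v = w := by
  refine Lp.ext ((weightMeasure_absolutelyContinuous_volume lam).ae_eq ?_)
  refine ae_eq_of_integral_contDiff_smul_eq (locallyIntegrable_weightedL2 v)
    (locallyIntegrable_weightedL2 w) fun g hg hc => ?_
  exact neg_injective ((hv g hg hc).symm.trans (hw g hg hc))

/-- The weighted Sobolev space
`H²_lam(ℝ) = {u ∈ L²_lam(ℝ) : u', u'' ∈ L²_lam(ℝ)}`, with weak derivatives. -/
def weightedH2 (lam : ℝ) : Submodule ℂ (WeightedL2 lam) where
  carrier := {u | ∃ u' u'' : WeightedL2 lam, IsWeakDeriv u u' ∧ IsWeakDeriv u' u''}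
  zero_mem' := ⟨0, 0, isWeakDeriv_zero lam, isWeakDeriv_zero lam⟩
  add_mem' := by
    rintro u v ⟨u', u'', hu, hu'⟩ ⟨v', v'', hv, hv'⟩
    exact ⟨u' + v', u'' + v'', hu.add hv, hu'.add hv'⟩
  smul_mem' := by
    rintro k u ⟨u', u'', hu, hu'⟩
    exact ⟨k • u', k • u'', hu.smul k, hu'.smul k⟩

/-! ### Operators with totally bounded coefficients -/

/-- A function on `ℝ` is totally bounded if it is smooth and it and all its derivatives are
bounded. -/
structure IsTotallyBounded (f : ℝ → ℝ) : Prop where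
  contDiff : ContDiff ℝ ∞ f
  bounded : ∀ n : ℕ, ∃ C : ℝ, ∀ x, |iteratedDeriv n f x| ≤ C

/-- `a ∂ₓ² + b ∂ₓ + c` with real coefficients is uniformly strongly elliptic on `ℝ`: its
coefficients are bounded, and `a ≥ ε` for some `ε > 0`. -/
structure IsUniformlyStronglyElliptic (a b c : ℝ → ℝ) : Prop where
  bounded_a : ∃ C : ℝ, ∀ x, |a x| ≤ C
  bounded_b : ∃ C : ℝ, ∀ x, |b x| ≤ C
  bounded_c : ∃ C : ℝ, ∀ x, |c x| ≤ C
  elliptic : ∃ ε : ℝ, 0 < ε ∧ ∀ x, ε ≤ a x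

theorem IsTotallyBounded.memLp {f : ℝ → ℝ} (hf : IsTotallyBounded f) {lam : ℝ}
    (u : WeightedL2 lam) : MemLp (fun x => f x • u x) 2 (weightMeasure lam) := by
  obtain ⟨C, hC⟩ := hf.bounded 0
  refine (Lp.memLp u).of_le_mul (c := C)
    (hf.contDiff.continuous.aestronglyMeasurable.smul (Lp.aestronglyMeasurable u))
    (Eventually.of_forall fun x => ?_)
  rw [norm_smul]
  exact mul_le_mul_of_nonneg_right (by simpa using hC x) (norm_nonneg _)

/-- Multiplication by a totally bounded function on `L²_lam(ℝ)`. -/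
def mulOp {f : ℝ → ℝ} (hf : IsTotallyBounded f) (lam : ℝ) :
    WeightedL2 lam →ₗ[ℂ] WeightedL2 lam where
  toFun u := (hf.memLp u).toLp fun x => f x • u x
  map_add' u v := by
    refine Lp.ext ?_
    filter_upwards [(hf.memLp (u + v)).coeFn_toLp, (hf.memLp u).coeFn_toLp,
      (hf.memLp v).coeFn_toLp, Lp.coeFn_add u v,
      Lp.coeFn_add ((hf.memLp u).toLp fun x => f x • u x)
        ((hf.memLp v).toLp fun x => f x • v x)] with x h1 h2 h3 h4 h5
    rw [h1, h5, Pi.add_apply, h2, h3, h4, Pi.add_apply, smul_add]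
  map_smul' k u := by
    refine Lp.ext ?_
    filter_upwards [(hf.memLp (k • u)).coeFn_toLp, (hf.memLp u).coeFn_toLp, Lp.coeFn_smul k u,
      Lp.coeFn_smul k ((hf.memLp u).toLp fun x => f x • u x)] with x h1 h2 h3 h4
    rw [h1, RingHom.id_apply, h4, Pi.smul_apply, h2, h3, Pi.smul_apply, smul_comm]

/-- The graph of `a ∂ₓ² + b ∂ₓ + c` on `H²_lam(ℝ)`. -/
def ellipticGraph (lam : ℝ) {a b c : ℝ → ℝ} (ha : IsTotallyBounded a) (hb : IsTotallyBounded b)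
    (hc : IsTotallyBounded c) : Submodule ℂ (WeightedL2 lam × WeightedL2 lam) where
  carrier := {p | ∃ u' u'' : WeightedL2 lam, IsWeakDeriv p.1 u' ∧ IsWeakDeriv u' u'' ∧
    p.2 = mulOp ha lam u'' + mulOp hb lam u' + mulOp hc lam p.1}
  zero_mem' := ⟨0, 0, isWeakDeriv_zero lam, isWeakDeriv_zero lam, by simp⟩
  add_mem' := by
    rintro p q ⟨u', u'', hu, hu', hp⟩ ⟨v', v'', hv, hv', hq⟩
    refine ⟨u' + v', u'' + v'', hu.add hv, hu'.add hv', ?_⟩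
    simp only [Prod.fst_add, Prod.snd_add, map_add, hp, hq]
    abel
  smul_mem' := by
    rintro k p ⟨u', u'', hu, hu', hp⟩
    refine ⟨k • u', k • u'', hu.smul k, hu'.smul k, ?_⟩
    simp only [Prod.smul_fst, Prod.smul_snd, map_smul, smul_add, hp]

/-- The unbounded operator `u ↦ a u'' + b u' + c u` on `L²_lam(ℝ)`, with domain `H²_lam(ℝ)`. -/
def ellipticOp (lam : ℝ) {a b c : ℝ → ℝ} (ha : IsTotallyBounded a) (hb : IsTotallyBounded b)
    (hc : IsTotallyBounded c) : WeightedL2 lam →ₗ.[ℂ] WeightedL2 lam :=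
  (ellipticGraph lam ha hb hc).toLinearPMap

theorem domain_ellipticOp (lam : ℝ) {a b c : ℝ → ℝ} (ha : IsTotallyBounded a)
    (hb : IsTotallyBounded b) (hc : IsTotallyBounded c) :
    (ellipticOp lam ha hb hc).domain = weightedH2 lam := by
  ext u
  rw [ellipticOp, Submodule.toLinearPMap_domain, Submodule.mem_map]
  constructor
  · rintro ⟨⟨u, f⟩, ⟨u', u'', hu, hu', -⟩, rfl⟩
    exact ⟨u', u'', hu, hu'⟩
  · rintro ⟨u', u'', hu, hu'⟩
    exact ⟨(u, mulOp ha lam u'' + mulOp hb lam u' + mulOp hc lam u), ⟨u', u'', hu, hu', rfl⟩, rfl⟩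

theorem mem_graph_ellipticOp (lam : ℝ) {a b c : ℝ → ℝ} (ha : IsTotallyBounded a)
    (hb : IsTotallyBounded b) (hc : IsTotallyBounded c) (u f : WeightedL2 lam) :
    (u, f) ∈ (ellipticOp lam ha hb hc).graph ↔
      ∃ u' u'' : WeightedL2 lam, IsWeakDeriv u u' ∧ IsWeakDeriv u' u'' ∧
        f = mulOp ha lam u'' + mulOp hb lam u' + mulOp hc lam u := by
  rw [ellipticOp, Submodule.toLinearPMap_graph_eq]
  · rfl
  · rintro ⟨u, f⟩ ⟨u', u'', hu, hu', hf⟩ (rfl : u = 0)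
    obtain rfl : u' = 0 := hu.unique (isWeakDeriv_zero lam)
    obtain rfl : u'' = 0 := hu'.unique (isWeakDeriv_zero lam)
    simpa using hf

/-- The graph of `∂ₓ² - ∂ₓ` on `H²_lam(ℝ)`. -/
def opBGraph (lam : ℝ) : Submodule ℂ (WeightedL2 lam × WeightedL2 lam) where
  carrier := {p | ∃ u' u'' : WeightedL2 lam, IsWeakDeriv p.1 u' ∧ IsWeakDeriv u' u'' ∧
    p.2 = u'' - u'}
  zero_mem' := ⟨0, 0, isWeakDeriv_zero lam, isWeakDeriv_zero lam, by simp⟩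
  add_mem' := by
    rintro ⟨u, f⟩ ⟨v, g⟩ ⟨u', u'', hu, hu', rfl⟩ ⟨v', v'', hv, hv', rfl⟩
    refine ⟨u' + v', u'' + v'', hu.add hv, hu'.add hv', ?_⟩
    simp only [Prod.mk_add_mk]
    abel
  smul_mem' := by
    rintro k ⟨u, f⟩ ⟨u', u'', hu, hu', rfl⟩
    refine ⟨k • u', k • u'', hu.smul k, hu'.smul k, ?_⟩
    simp only [Prod.smul_mk, smul_sub]

/-- The unbounded operator `B = ∂ₓ² - ∂ₓ` on `L²_lam(ℝ)`, with domain `H²_lam(ℝ)`. -/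
def opB (lam : ℝ) : WeightedL2 lam →ₗ.[ℂ] WeightedL2 lam :=
  (opBGraph lam).toLinearPMap

theorem domain_opB (lam : ℝ) : (opB lam).domain = weightedH2 lam := by
  ext u
  rw [opB, Submodule.toLinearPMap_domain, Submodule.mem_map]
  constructor
  · rintro ⟨⟨u, f⟩, ⟨u', u'', hu, hu', -⟩, rfl⟩
    exact ⟨u', u'', hu, hu'⟩
  · rintro ⟨u', u'', hu, hu'⟩
    exact ⟨(u, _), ⟨u', u'', hu, hu', rfl⟩, rfl⟩

theorem mem_graph_opB (lam : ℝ) (u f : WeightedL2 lam) :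
    (u, f) ∈ (opB lam).graph ↔
      ∃ u' u'' : WeightedL2 lam, IsWeakDeriv u u' ∧ IsWeakDeriv u' u'' ∧ f = u'' - u' := by
  rw [opB, Submodule.toLinearPMap_graph_eq]
  · rfl
  · rintro ⟨u, f⟩ ⟨u', u'', hu, hu', hf⟩ (rfl : u = 0)
    obtain rfl : u' = 0 := hu.unique (isWeakDeriv_zero lam)
    obtain rfl : u'' = 0 := hu'.unique (isWeakDeriv_zero lam)
    simpa using hf

end WeightedSemigroup

end

namespace WeightedSemigroup

/-! ### The sector of half-angle `π / 4` and the closed cone containing it -/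

/-! The space `L²_lam` is a Hilbert space, and its weight `w = e^{-2 lam ⟨x⟩}` has the bounded
logarithmic derivative `-2 lam x / ⟨x⟩`. Integration by parts therefore produces only bounded lower
order terms: `⟪v, T u⟫ = -⟪v', a u'⟫ + ⟪v, (b - (a w)' / w) u'⟫ + ⟪v, c u⟫` (`inner_elliptic`). The
leading part is real and coercive in `u'` when `v = u`, so after subtracting a large constant `κ`
one has `Re (z ⟪u, (T - κ) u⟫) ≤ 0` for every `z` with `|Im z| ≤ Re z` (`re_mul_form_le`).
Lax–Milgram on `H¹_lam` solves `(μ - (T - κ)) u = f` weakly for all `μ > 0`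
(`exists_weak_solution`), and the equation itself exhibits `u''` as an element of `L²_lam`
(`exists_isWeakDeriv_of_weak`).

These two facts suffice for generation in any Hilbert space, without contour integrals of the
resolvent. The Yosida approximations `A n` are bounded, commute, inherit the numerical range
condition, and converge on the dense domain. Since `‖exp (s z A n) x‖²` decreases in `s`, the
operators `exp (z A n)` are contractions on the whole cone; commutation makes them converge strongly
(`norm_exp_smul_sub_exp_smul_le`). The limit is a contraction semigroup on the cone, strongly
holomorphic inside it, hence holomorphic in norm (`analyticOnNhd_of_differentiableOn_apply`). Its
generator extends `T - κ`, and equals it because it is dissipative while `1 - (T - κ)` is already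
onto (`mem_iff_tendsto`). Multiplication by `e^{κ z}` removes the shift. The half-angle `π / 4` is
chosen because its sector is cut out by the linear condition `|Im z| < Re z`. -/

theorem mem_sector_pi_div_four {z : ℂ} : z ∈ sector (Real.pi / 4) ↔ |z.im| < z.re := by
  have hpi := Real.pi_pos
  by_cases hz : 0 < z.re
  · have harg : |z.arg| < Real.pi / 2 := Complex.abs_arg_lt_pi_div_two_iff.2 (Or.inl hz)
    have hz0 : z ≠ 0 := by rintro rfl; simp at hz
    rw [abs_lt] at harg
    have ht := Complex.tan_arg z
    have key : ∀ s t : ℝ, s ∈ Ioo (-(Real.pi / 2)) (Real.pi / 2) →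
        t ∈ Ioo (-(Real.pi / 2)) (Real.pi / 2) → (Real.tan s < Real.tan t ↔ s < t) :=
      fun s t hs ht => Real.strictMonoOn_tan.lt_iff_lt hs ht
    have h1 := key z.arg (Real.pi / 4) ⟨harg.1, harg.2⟩ ⟨by linarith, by linarith⟩
    have h2 := key (-(Real.pi / 4)) z.arg ⟨by linarith, by linarith⟩ ⟨harg.1, harg.2⟩
    rw [Real.tan_neg] at h2
    rw [Real.tan_pi_div_four, ht] at h1 h2
    change z ≠ 0 ∧ |z.arg| < Real.pi / 4 ↔ _
    rw [abs_lt, abs_lt, ← h1, ← h2, div_lt_iff₀ hz, lt_div_iff₀ hz]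
    simp [hz0]
  · constructor
    · rintro ⟨h0, h⟩
      rcases Complex.abs_arg_lt_pi_div_two_iff.1 (h.trans (by linarith)) with h | h
      · exact absurd h hz
      · exact absurd h h0
    · intro h
      exact absurd ((abs_nonneg _).trans_lt h) hz

/-- The closed convex cone `{z | |Im z| ≤ Re z}`. -/
def closedCone : Set ℂ := {z | |z.im| ≤ z.re}

theorem zero_mem_closedCone : (0 : ℂ) ∈ closedCone := by simp [closedCone]

theorem sector_subset_closedCone : sector (Real.pi / 4) ⊆ closedCone :=
  fun _ hz => (mem_sector_pi_div_four.1 hz).le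

theorem sector_union_zero_subset_closedCone : sector (Real.pi / 4) ∪ {0} ⊆ closedCone :=
  union_subset sector_subset_closedCone (by simpa using zero_mem_closedCone)

theorem add_mem_closedCone {z w : ℂ} (hz : z ∈ closedCone) (hw : w ∈ closedCone) :
    z + w ∈ closedCone := by
  have h := abs_add_le z.im w.im
  simp only [closedCone, mem_ofPred_eq, Complex.add_im, Complex.add_re] at *
  linarith

theorem real_smul_mem_closedCone {z : ℂ} (hz : z ∈ closedCone) {s : ℝ} (hs : 0 ≤ s) :
    (s : ℂ) * z ∈ closedCone := by
  simp only [closedCone, mem_ofPred_eq, Complex.re_ofReal_mul, Complex.im_ofReal_mul, abs_mul,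
    abs_of_nonneg hs] at *
  exact mul_le_mul_of_nonneg_left hz hs

theorem ofReal_mem_closedCone {s : ℝ} (hs : 0 ≤ s) : (s : ℂ) ∈ closedCone := by
  simpa [closedCone] using hs

theorem isOpen_sector_pi_div_four : IsOpen (sector (Real.pi / 4)) := by
  have : sector (Real.pi / 4) = {z : ℂ | |z.im| < z.re} := by
    ext z; exact mem_sector_pi_div_four
  rw [this]
  exact isOpen_lt (by fun_prop) (by fun_prop)

section Banach

variable {X : Type*} [NormedAddCommGroup X] [NormedSpace ℂ X]

/-! ### Strongly holomorphic families are holomorphic in norm -/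

/-- A uniformly bounded family of operators on an open set which is strongly holomorphic is
analytic for the operator norm. -/
theorem analyticOnNhd_of_differentiableOn_apply [CompleteSpace X] {S : ℂ → X →L[ℂ] X} {U : Set ℂ}
    (hU : IsOpen U)
    (hS : ∀ x, DifferentiableOn ℂ (fun z => S z x) U) {M : ℝ} (hM : ∀ z ∈ U, ‖S z‖ ≤ M) :
    AnalyticOnNhd ℂ S U := by
  intro z₀ hz₀
  obtain ⟨ε, hε, hball⟩ := Metric.isOpen_iff.1 hU z₀ hz₀
  -- A third of the radius leaves room for a disc of radius `r` around every point of the closed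
  -- `r`-disc.
  obtain ⟨r, rfl⟩ : ∃ r, ε = 3 * r := ⟨ε / 3, by ring⟩
  have hr : 0 < r := by linarith
  have hsub : ∀ z ∈ Metric.closedBall z₀ r, Metric.closedBall z r ⊆ U := by
    intro z hz w hw
    refine hball ?_
    rw [Metric.mem_closedBall] at hz hw
    rw [Metric.mem_ball]
    linarith [dist_triangle w z z₀]
  have hM0 : 0 ≤ M := (norm_nonneg _).trans (hM z₀ hz₀)
  -- The Cauchy estimate is linear in `‖x‖`, so it makes `S` Lipschitz in operator norm; this
  -- continuity lets the Cauchy integral of `S` be taken in the space of operators.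
  have hder : ∀ x, ∀ z ∈ Metric.closedBall z₀ r, ‖deriv (fun z => S z x) z‖ ≤ M * ‖x‖ / r := by
    intro x z hz
    refine Complex.norm_deriv_le_of_forall_mem_sphere_norm_le hr ?_ fun w hw => ?_
    · refine DifferentiableOn.diffContOnCl ((hS x).mono ?_)
      rw [closure_ball _ hr.ne']
      exact hsub z hz
    · exact (S w).le_of_opNorm_le (hM w (hsub z hz (Metric.sphere_subset_closedBall hw))) x
  have hcont : ContinuousOn S (Metric.closedBall z₀ r) := by
    have hlip : LipschitzOnWith (Real.toNNReal (M / r)) S (Metric.closedBall z₀ r) := by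
      refine LipschitzOnWith.of_dist_le_mul fun z hz w hw => ?_
      rw [Real.coe_toNNReal _ (by positivity), dist_eq_norm, dist_eq_norm]
      refine ContinuousLinearMap.opNorm_le_bound _ (by positivity) fun x => ?_
      have := (convex_closedBall z₀ r).norm_image_sub_le_of_norm_deriv_le
        (f := fun z => S z x) (x := w) (y := z) (C := M * ‖x‖ / r)
        (fun y hy => (hS x).differentiableAt (hU.mem_nhds
          (hsub y hy (Metric.mem_closedBall_self hr.le)))) (hder x) hw hz
      rw [_root_.sub_apply]
      refine this.trans (le_of_eq ?_)
      ring
    exact hlip.continuousOn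
  have hci : CircleIntegrable S z₀ r :=
    (hcont.mono Metric.sphere_subset_closedBall).circleIntegrable hr.le
  lift r to NNReal using hr.le
  -- The operator-valued Cauchy integral is analytic for any continuous integrand. It equals `S`
  -- because, applied to each `x`, it is the Cauchy formula for `S z x`.
  have hps := (hasFPowerSeriesOn_cauchy_integral hci (by exact_mod_cast hr)).analyticAt
  refine hps.congr ?_
  filter_upwards [Metric.ball_mem_nhds z₀ hr] with w hw
  ext x
  have hx : DiffContOnCl ℂ (fun z => S z x) (Metric.ball z₀ r) := by
    refine DifferentiableOn.diffContOnCl ((hS x).mono ?_)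
    rw [closure_ball _ hr.ne']
    exact hsub z₀ (Metric.mem_closedBall_self hr.le)
  rw [← hx.two_pi_i_inv_smul_circleIntegral_sub_inv_smul hw, _root_.smul_apply]
  congr 1
  rw [circleIntegral, circleIntegral, ContinuousLinearMap.intervalIntegral_apply]
  · simp
  · have h2 : CircleIntegrable (fun z => (z - w)⁻¹ • S z) z₀ r := by
      refine ContinuousOn.circleIntegrable hr.le ?_
      have hinv : ContinuousOn (fun z => (z - w)⁻¹) (Metric.sphere z₀ r) := by
        refine ContinuousOn.inv₀ (by fun_prop) fun z hz h => ?_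
        rw [sub_eq_zero] at h
        subst h
        rw [Metric.mem_sphere] at hz
        rw [Metric.mem_ball] at hw
        exact hw.ne hz
      exact hinv.smul (hcont.mono Metric.sphere_subset_closedBall)
    exact h2.out

/-! ### Semigroups as limits of exponentials of commuting bounded operators -/

theorem exp_add_of_commute_clm [CompleteSpace X] {A B : X →L[ℂ] X} (h : Commute A B) :
    NormedSpace.exp (A + B) = NormedSpace.exp A * NormedSpace.exp B := by
  let _ : NormedAlgebra ℚ (X →L[ℂ] X) := NormedAlgebra.restrictScalars ℚ ℂ _
  exact NormedSpace.exp_add_of_commute h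

/-- The derivative of `s ↦ exp (s z A) x` along the real line. -/
theorem hasDerivAt_exp_real_smul_apply [CompleteSpace X] (A : X →L[ℂ] X) (x : X) (s : ℝ) :
    HasDerivAt (fun s : ℝ => NormedSpace.exp ((s : ℂ) • A) x)
      (NormedSpace.exp ((s : ℂ) • A) (A x)) s := by
  have h := hasDerivAt_exp_smul_const (𝕂 := ℝ) A s
  have h2 := ((ContinuousLinearMap.apply ℂ X x).restrictScalars ℝ).hasFDerivAt.comp_hasDerivAt s h
  simpa [Function.comp_def] using h2

/-- The path `s ↦ exp (s z A) exp ((1 - s) z B) x` joins `exp (z B) x` to `exp (z A) x`. By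
commutation it equals `exp (z B) exp (s z (A - B)) x`, so its derivative is a product of two
contractions applied to `z (A - B) x`, and the mean value inequality concludes. -/
theorem norm_exp_smul_sub_exp_smul_le [CompleteSpace X] {A B : X →L[ℂ] X} (hAB : Commute A B)
    (hA : ∀ z ∈ closedCone, ‖NormedSpace.exp (z • A)‖ ≤ 1)
    (hB : ∀ z ∈ closedCone, ‖NormedSpace.exp (z • B)‖ ≤ 1) {z : ℂ} (hz : z ∈ closedCone) (x : X) :
    ‖NormedSpace.exp (z • A) x - NormedSpace.exp (z • B) x‖ ≤ ‖z‖ * ‖A x - B x‖ := by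
  have hc : Commute A (A - B) := (Commute.refl A).sub_right hAB
  have hc2 : Commute B (A - B) := hAB.symm.sub_right (Commute.refl B)
  have hmul : ∀ s : ℝ, NormedSpace.exp (z • B) * NormedSpace.exp ((s : ℂ) • (z • (A - B))) =
      NormedSpace.exp (((s : ℂ) * z) • A) * NormedSpace.exp (((1 - s : ℝ) * z : ℂ) • B) := by
    intro s
    rw [← exp_add_of_commute_clm, ← exp_add_of_commute_clm]
    · congr 1
      push_cast
      module
    · exact (hAB.smul_left _).smul_right _
    · exact ((hc2.smul_left _).smul_right _).smul_right _
  have hd : ∀ s : ℝ, HasDerivAt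
      (fun s : ℝ => NormedSpace.exp (z • B) (NormedSpace.exp ((s : ℂ) • (z • (A - B))) x))
      (NormedSpace.exp (z • B) (NormedSpace.exp ((s : ℂ) • (z • (A - B))) ((z • (A - B)) x))) s :=
    fun s => ((NormedSpace.exp (z • B)).restrictScalars ℝ).hasFDerivAt.comp_hasDerivAt s
      (hasDerivAt_exp_real_smul_apply (z • (A - B)) x s)
  have h := norm_image_sub_le_of_norm_deriv_le_segment_01' (C := ‖z‖ * ‖A x - B x‖)
    (fun s _ => (hd s).hasDerivWithinAt) ?_
  · have h1 := hmul 1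
    have h0 := hmul 0
    have e : ∀ T T' : X →L[ℂ] X, T (T' x) = (T * T') x := fun _ _ => rfl
    simp only [e] at h
    rw [h1, h0] at h
    simpa using h
  · intro s hs
    have e : ∀ y, NormedSpace.exp (z • B) (NormedSpace.exp ((s : ℂ) • (z • (A - B))) y) =
        NormedSpace.exp (((s : ℂ) * z) • A) (NormedSpace.exp (((1 - s : ℝ) * z : ℂ) • B) y) :=
      fun y => congrArg (fun T : X →L[ℂ] X => T y) (hmul s)
    rw [e]
    refine ((ContinuousLinearMap.le_of_opNorm_le _
      (hA _ (real_smul_mem_closedCone hz hs.1)) _).trans ?_)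
    rw [one_mul]
    refine ((ContinuousLinearMap.le_of_opNorm_le _
      (hB _ (real_smul_mem_closedCone hz (by linarith [hs.2]))) _).trans ?_)
    rw [one_mul, _root_.smul_apply, norm_smul, _root_.sub_apply]

theorem norm_exp_smul_sub_self_le [CompleteSpace X] {A : X →L[ℂ] X}
    (hA : ∀ z ∈ closedCone, ‖NormedSpace.exp (z • A)‖ ≤ 1) {z : ℂ} (hz : z ∈ closedCone) (x : X) :
    ‖NormedSpace.exp (z • A) x - x‖ ≤ ‖z‖ * ‖A x‖ := by
  have h := norm_exp_smul_sub_exp_smul_le (B := 0) (Commute.zero_right A) hA ?_ hz x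
  · simpa [NormedSpace.exp_zero] using h
  · intro w _
    rw [smul_zero, NormedSpace.exp_zero]
    exact ContinuousLinearMap.norm_id_le

/-- A first order Taylor estimate, by the mean value inequality for `exp (s A) x - s A x`. The bound
does not involve `‖A‖`, so it survives a limit along unbounded approximations. -/
theorem norm_exp_smul_sub_self_sub_le [CompleteSpace X] {A : X →L[ℂ] X} {t C : ℝ} (ht : 0 ≤ t)
    (x : X)
    (hC : ∀ s ∈ Icc 0 t, ‖NormedSpace.exp ((s : ℂ) • A) (A x) - A x‖ ≤ C) :
    ‖NormedSpace.exp ((t : ℂ) • A) x - x - (t : ℂ) • A x‖ ≤ C * t := by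
  have hd : ∀ s : ℝ, HasDerivAt
      (fun s : ℝ => NormedSpace.exp ((s : ℂ) • A) x - (s : ℂ) • A x)
      (NormedSpace.exp ((s : ℂ) • A) (A x) - A x) s := by
    intro s
    refine (hasDerivAt_exp_real_smul_apply A x s).sub ?_
    simpa using ((hasDerivAt_id s).ofReal_comp).smul_const (A x)
  have h := norm_image_sub_le_of_norm_deriv_le_segment' (a := 0) (b := t) (C := C)
    (fun s _ => (hd s).hasDerivWithinAt) (fun s hs => hC s ⟨hs.1, hs.2.le⟩) t ⟨ht, le_rfl⟩
  refine le_of_eq_of_le ?_ (h.trans (by simp))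
  congr 1
  simp only [Complex.ofReal_zero, zero_smul, NormedSpace.exp_zero, sub_zero,
    one_apply_eq_self]
  abel

end Banach

/-! ### The limit semigroup of a generating sequence -/

section Limit

variable {X : Type*} [NormedAddCommGroup X] [NormedSpace ℂ X]

/-- A sequence of commuting bounded operators whose exponentials are contractions on the closed
cone, and which converges on a dense set of vectors. -/
structure IsGeneratingSequence (A : ℕ → X →L[ℂ] X) : Prop where
  comm : ∀ m n, Commute (A m) (A n)
  contr : ∀ n, ∀ z ∈ closedCone, ‖NormedSpace.exp (z • A n)‖ ≤ 1
  dense : Dense {x | ∃ y, Tendsto (fun n => A n x) atTop (𝓝 y)}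

/-- Transfers estimates for contractions from a dense set of vectors `x'` to all `x`. -/
theorem norm_apply_sub_apply_le {T T' : X →L[ℂ] X} (hT : ‖T‖ ≤ 1) (hT' : ‖T'‖ ≤ 1) (x x' : X) :
    ‖T x - T' x‖ ≤ 2 * ‖x - x'‖ + ‖T x' - T' x'‖ := by
  have h1 : T x - T' x = T (x - x') - T' (x - x') + (T x' - T' x') := by
    simp only [map_sub]; abel
  have h2 := T.le_of_opNorm_le hT (x - x')
  have h3 := T'.le_of_opNorm_le hT' (x - x')
  rw [h1]
  refine (norm_add_le _ _).trans ?_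
  have := norm_sub_le (T (x - x')) (T' (x - x'))
  linarith

namespace IsGeneratingSequence

variable {A : ℕ → X →L[ℂ] X}

theorem exists_near (h : IsGeneratingSequence A) (x : X) {ε : ℝ} (hε : 0 < ε) :
    ∃ x' y', ‖x - x'‖ < ε ∧ Tendsto (fun n => A n x') atTop (𝓝 y') := by
  obtain ⟨x', ⟨y', hy'⟩, hx'⟩ := h.dense.exists_dist_lt x hε
  exact ⟨x', y', by rwa [← dist_eq_norm], hy'⟩

variable [CompleteSpace X]

theorem exists_tendsto_exp (h : IsGeneratingSequence A) {z : ℂ} (hz : z ∈ closedCone) (x : X) :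
    ∃ y, Tendsto (fun n => NormedSpace.exp (z • A n) x) atTop (𝓝 y) := by
  refine cauchySeq_tendsto_of_complete (Metric.cauchySeq_iff'.2 fun ε hε => ?_)
  -- Twice `ε / 4` pays for replacing `x` by `x'`, and the Cauchy property of `A n x'` supplies the
  -- other `ε / 2`; the `+ 1` in its denominator allows `z = 0`.
  obtain ⟨x', y', hx', hy'⟩ := h.exists_near x (ε := ε / 4) (by linarith)
  obtain ⟨N, hN⟩ := Metric.cauchySeq_iff'.1 hy'.cauchySeq (ε / (2 * (‖z‖ + 1))) (by positivity)
  refine ⟨N, fun n hn => ?_⟩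
  rw [dist_eq_norm]
  refine (norm_apply_sub_apply_le (h.contr n z hz) (h.contr N z hz) x x').trans_lt ?_
  have h1 := norm_exp_smul_sub_exp_smul_le (h.comm n N) (h.contr n) (h.contr N) hz x'
  have h2 := hN n hn
  rw [dist_eq_norm, lt_div_iff₀ (by positivity)] at h2
  have h3 : 0 ≤ ‖A n x' - A N x'‖ := norm_nonneg _
  nlinarith

/-- The condition on `z` stands inside the existential so that `limit` is a total function of `z`;
off the cone its value is irrelevant. -/
theorem exists_limit (h : IsGeneratingSequence A) (z : ℂ) :
    ∃ T : X →L[ℂ] X, z ∈ closedCone →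
      ‖T‖ ≤ 1 ∧ ∀ x, Tendsto (fun n => NormedSpace.exp (z • A n) x) atTop (𝓝 (T x)) := by
  by_cases hz : z ∈ closedCone
  · choose f hf using h.exists_tendsto_exp hz
    let T : X →ₗ[ℂ] X :=
      { toFun := f
        map_add' := fun x y => tendsto_nhds_unique (hf (x + y))
          (((hf x).add (hf y)).congr fun n => (map_add _ x y).symm)
        map_smul' := fun k x => tendsto_nhds_unique (hf (k • x))
          (((hf x).const_smul k).congr fun n => (map_smul _ k x).symm) }
    have hT : ∀ x, ‖T x‖ ≤ 1 * ‖x‖ := fun x =>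
      le_of_tendsto (hf x).norm (Eventually.of_forall fun n =>
        (NormedSpace.exp (z • A n)).le_of_opNorm_le (h.contr n z hz) x)
    exact ⟨T.mkContinuous 1 hT, fun _ =>
      ⟨LinearMap.mkContinuous_norm_le _ zero_le_one _, hf⟩⟩
  · exact ⟨0, fun h => absurd h hz⟩

/-- The strong limit of the exponentials `exp (z A n)`. -/
noncomputable def limit (h : IsGeneratingSequence A) (z : ℂ) : X →L[ℂ] X :=
  (h.exists_limit z).choose

theorem norm_limit_le (h : IsGeneratingSequence A) {z : ℂ} (hz : z ∈ closedCone) :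
    ‖h.limit z‖ ≤ 1 :=
  ((h.exists_limit z).choose_spec hz).1

theorem tendsto_limit (h : IsGeneratingSequence A) {z : ℂ} (hz : z ∈ closedCone) (x : X) :
    Tendsto (fun n => NormedSpace.exp (z • A n) x) atTop (𝓝 (h.limit z x)) :=
  ((h.exists_limit z).choose_spec hz).2 x

/-- The commuting estimate with its second index sent to infinity. The rate depends on `z` only
through `‖z‖`, whence convergence uniform on bounded parts of the cone. -/
theorem norm_exp_sub_limit_le (h : IsGeneratingSequence A) {z : ℂ} (hz : z ∈ closedCone)
    {x y : X} (hy : Tendsto (fun n => A n x) atTop (𝓝 y)) (n : ℕ) :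
    ‖NormedSpace.exp (z • A n) x - h.limit z x‖ ≤ ‖z‖ * ‖A n x - y‖ := by
  refine le_of_tendsto_of_tendsto
    ((tendsto_const_nhds.sub (h.tendsto_limit hz x)).norm)
    (((tendsto_const_nhds (x := A n x)).sub hy).norm.const_mul ‖z‖)
    (Eventually.of_forall fun m => ?_)
  exact norm_exp_smul_sub_exp_smul_le (h.comm n m) (h.contr n) (h.contr m) hz x

theorem norm_limit_sub_self_le (h : IsGeneratingSequence A) {z : ℂ} (hz : z ∈ closedCone)
    {x y : X} (hy : Tendsto (fun n => A n x) atTop (𝓝 y)) :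
    ‖h.limit z x - x‖ ≤ ‖z‖ * ‖y‖ :=
  le_of_tendsto_of_tendsto ((h.tendsto_limit hz x).sub_const x).norm (hy.norm.const_mul ‖z‖)
    (Eventually.of_forall fun n => norm_exp_smul_sub_self_le (h.contr n) hz x)

/-- Weierstrass: locally uniform limits of holomorphic functions are holomorphic. -/
theorem differentiableOn_limit_apply (h : IsGeneratingSequence A) (x : X) :
    DifferentiableOn ℂ (fun z => h.limit z x) (sector (Real.pi / 4)) := by
  refine TendstoLocallyUniformlyOn.differentiableOn (φ := atTop)
    (F := fun (n : ℕ) (z : ℂ) => NormedSpace.exp (z • A n) x) ?_ ?_ isOpen_sector_pi_div_four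
  · rw [Metric.tendstoLocallyUniformlyOn_iff]
    intro ε hε z _
    obtain ⟨x', y', hx', hy'⟩ := h.exists_near x (ε := ε / 4) (by linarith)
    refine ⟨Metric.ball z 1 ∩ sector (Real.pi / 4),
      inter_mem (mem_nhdsWithin_of_mem_nhds (Metric.ball_mem_nhds z one_pos))
        self_mem_nhdsWithin, ?_⟩
    have hev := Metric.tendsto_nhds.1 hy' (ε / (2 * (‖z‖ + 1))) (by positivity)
    filter_upwards [hev] with n hn w hw
    have hwc := sector_subset_closedCone hw.2
    rw [dist_comm, dist_eq_norm]
    refine (norm_apply_sub_apply_le (h.contr n w hwc) (h.norm_limit_le hwc) x x').trans_lt ?_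
    have h1 := h.norm_exp_sub_limit_le hwc hy' n
    have h2 : ‖w‖ ≤ ‖z‖ + 1 := by
      have := norm_le_norm_add_norm_sub' w z
      have h3 := hw.1
      rw [Metric.mem_ball, dist_eq_norm] at h3
      linarith
    rw [dist_eq_norm, lt_div_iff₀ (by positivity)] at hn
    have h3 : ‖w‖ * ‖A n x' - y'‖ ≤ (‖z‖ + 1) * ‖A n x' - y'‖ := by gcongr
    linarith
  · refine Eventually.of_forall fun n => Differentiable.differentiableOn fun z => ?_
    exact ((hasDerivAt_exp_smul_const (𝕂 := ℂ) (A n) z).differentiableAt).clm_apply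
      (differentiableAt_const x)

theorem isAnalyticSemigroup (h : IsGeneratingSequence A) :
    IsAnalyticSemigroup (Real.pi / 4) h.limit where
  pos := by positivity
  le_pi_div_two := by linarith [Real.pi_pos]
  analytic := analyticOnNhd_of_differentiableOn_apply isOpen_sector_pi_div_four
    h.differentiableOn_limit_apply fun _ hz => h.norm_limit_le (sector_subset_closedCone hz)
  map_add := by
    intro z hz w hw
    replace hz := sector_union_zero_subset_closedCone hz
    replace hw := sector_union_zero_subset_closedCone hw
    ext x
    refine tendsto_nhds_unique (h.tendsto_limit (add_mem_closedCone hz hw) x) ?_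
    rw [tendsto_iff_norm_sub_tendsto_zero]
    have h1 := tendsto_iff_norm_sub_tendsto_zero.1 (h.tendsto_limit hz (h.limit w x))
    have h2 := tendsto_iff_norm_sub_tendsto_zero.1 (h.tendsto_limit hw x)
    refine squeeze_zero (fun _ => norm_nonneg _) (fun n => ?_)
      (by simpa using h2.add h1)
    have e : NormedSpace.exp ((z + w) • A n) =
        NormedSpace.exp (z • A n) * NormedSpace.exp (w • A n) := by
      rw [add_smul, exp_add_of_commute_clm]
      exact ((Commute.refl _).smul_left _).smul_right _
    -- Strong limits multiply here because the left factors are contractions uniformly in `n`.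
    have e2 : NormedSpace.exp ((z + w) • A n) x - (h.limit z ∘L h.limit w) x =
        NormedSpace.exp (z • A n) (NormedSpace.exp (w • A n) x - h.limit w x) +
          (NormedSpace.exp (z • A n) (h.limit w x) - h.limit z (h.limit w x)) := by
      rw [e, map_sub]
      simp
    rw [e2]
    refine (norm_add_le _ _).trans ?_
    gcongr
    simpa using ContinuousLinearMap.le_of_opNorm_le _ (h.contr n z hz)
      (NormedSpace.exp (w • A n) x - h.limit w x)
  map_zero := by
    ext x
    refine tendsto_nhds_unique (h.tendsto_limit zero_mem_closedCone x) ?_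
    simp [NormedSpace.exp_zero]
  tendsto_zero := by
    intro x
    rw [Metric.tendsto_nhdsWithin_nhds]
    intro ε hε
    obtain ⟨x', y', hx', hy'⟩ := h.exists_near x (ε := ε / 4) (by linarith)
    refine ⟨ε / (2 * (‖y'‖ + 1)), by positivity, fun z hz hz0 => ?_⟩
    have hzc := sector_subset_closedCone hz
    have h1 := norm_apply_sub_apply_le (h.norm_limit_le hzc)
      (ContinuousLinearMap.norm_id_le (𝕜 := ℂ) (E := X)) x x'
    have h2 := h.norm_limit_sub_self_le hzc hy'
    rw [dist_zero_right, lt_div_iff₀ (by positivity)] at hz0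
    rw [dist_eq_norm]
    simp only [ContinuousLinearMap.id_apply] at h1
    have := norm_nonneg z
    nlinarith

/-- The Taylor estimate holds for each `A n` with a bound controlled as `n → ∞`; passing to the
limit in `n` at fixed `t` leaves a remainder that is small relative to `t`. -/
theorem tendsto_generator (h : IsGeneratingSequence A) {x y : X}
    (hy : Tendsto (fun n => A n x) atTop (𝓝 y)) :
    Tendsto (fun t : ℝ => ((t⁻¹ : ℝ) : ℂ) • (h.limit (t : ℂ) x - x)) (𝓝[>] 0) (𝓝 y) := by
  rw [Metric.tendsto_nhdsWithin_nhds]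
  intro ε hε
  -- The remainder involves `exp (s A n) (A n x) - A n x`, and `y` need not lie where `A n`
  -- converges. A nearby `y₁` does, and bounds it by `2 ‖A n x - y₁‖ + t ‖A n y₁‖`.
  obtain ⟨y₁, y₂, hy₁, hy₂⟩ := h.exists_near y (ε := ε / 4) (by linarith)
  refine ⟨ε / (2 * (‖y₂‖ + 1)), by positivity, fun t ht ht0 => ?_⟩
  rw [mem_Ioi] at ht
  rw [dist_zero_right, Real.norm_of_nonneg ht.le, lt_div_iff₀ (by positivity)] at ht0
  have hn : ∀ n, ‖NormedSpace.exp ((t : ℂ) • A n) x - x - (t : ℂ) • A n x‖ ≤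
      (2 * ‖A n x - y₁‖ + t * ‖A n y₁‖) * t := by
    intro n
    refine norm_exp_smul_sub_self_sub_le ht.le x fun s hs => ?_
    have hsc := ofReal_mem_closedCone hs.1
    have h1 := norm_apply_sub_apply_le (h.contr n s hsc)
      (ContinuousLinearMap.norm_id_le (𝕜 := ℂ) (E := X)) (A n x) y₁
    have h2 := norm_exp_smul_sub_self_le (h.contr n) hsc y₁
    rw [Complex.norm_real, Real.norm_of_nonneg hs.1] at h2
    have h3 : s * ‖A n y₁‖ ≤ t * ‖A n y₁‖ := by gcongr; exact hs.2
    simp only [ContinuousLinearMap.id_apply] at h1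
    linarith
  have hlim := le_of_tendsto_of_tendsto
    (((h.tendsto_limit (ofReal_mem_closedCone ht.le) x).sub_const x).sub
      (hy.const_smul (t : ℂ))).norm
    ((((hy.sub_const y₁).norm.const_mul 2).add (hy₂.norm.const_mul t)).mul_const t)
    (Eventually.of_forall hn)
  have e : ((t⁻¹ : ℝ) : ℂ) • (h.limit (t : ℂ) x - x) - y =
      ((t⁻¹ : ℝ) : ℂ) • (h.limit (t : ℂ) x - x - (t : ℂ) • y) := by
    rw [smul_sub _ (h.limit (t : ℂ) x - x), smul_smul]
    have : (t : ℂ) ≠ 0 := by exact_mod_cast ht.ne'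
    simp [this]
  rw [dist_eq_norm, e, norm_smul, Complex.norm_real, norm_inv, Real.norm_of_nonneg ht.le,
    inv_mul_lt_iff₀ ht]
  refine hlim.trans_lt ?_
  rw [mul_comm]
  gcongr
  nlinarith [norm_nonneg y₂]

end IsGeneratingSequence

end Limit

/-! ### Generation from a sectorial numerical range in a Hilbert space -/

section Hilbert

variable {H : Type*} [NormedAddCommGroup H] [InnerProductSpace ℂ H]

/-- A bounded operator with numerical range in the sector opposite to `closedCone` generates
exponentials which are contractive on `closedCone`. -/
theorem norm_exp_smul_le_one [CompleteSpace H] {A : H →L[ℂ] H}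
    (hA : ∀ z ∈ closedCone, ∀ x, (z * inner ℂ x (A x)).re ≤ 0) {z : ℂ} (hz : z ∈ closedCone) :
    ‖NormedSpace.exp (z • A)‖ ≤ 1 := by
  refine ContinuousLinearMap.opNorm_le_bound _ zero_le_one fun x => ?_
  rw [one_mul]
  -- With `y = exp (s z A) x`, the derivative of `‖y‖²` is `2 Re (z ⟪y, A y⟫)`, which is nonpositive
  -- by hypothesis.
  have hd : ∀ s : ℝ, HasDerivAt (fun s : ℝ => ‖NormedSpace.exp ((s : ℂ) • (z • A)) x‖ ^ 2)
      (2 * (z * inner ℂ (NormedSpace.exp ((s : ℂ) • (z • A)) x)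
        (A (NormedSpace.exp ((s : ℂ) • (z • A)) x))).re) s := by
    intro s
    have h := (hasDerivAt_exp_real_smul_apply (z • A) x s)
    have hcomm : NormedSpace.exp ((s : ℂ) • (z • A)) ((z • A) x) =
        (z • A) (NormedSpace.exp ((s : ℂ) • (z • A)) x) := by
      have hc : Commute (NormedSpace.exp ((s : ℂ) • (z • A))) (z • A) :=
        ((Commute.refl (z • A)).smul_left _).exp_left
      exact congrArg (fun T : H →L[ℂ] H => T x) hc.eq
    rw [hcomm] at h
    have h2 := Complex.reCLM.hasFDerivAt.comp_hasDerivAt s (h.inner ℂ h)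
    refine (h2.congr_deriv ?_).congr_of_eventuallyEq (Eventually.of_forall fun t => ?_)
    · rw [Complex.reCLM_apply, Complex.add_re, _root_.smul_apply, inner_smul_right]
      have hsymm : ∀ v w : H, (inner ℂ v w).re = (inner ℂ w v).re := inner_re_symm (𝕜 := ℂ)
      rw [hsymm (z • _), inner_smul_right]
      ring
    · exact (inner_self_eq_norm_sq (𝕜 := ℂ) _).symm
  have hanti : AntitoneOn (fun s : ℝ => ‖NormedSpace.exp ((s : ℂ) • (z • A)) x‖ ^ 2)
      (Icc 0 1) := by
    refine antitoneOn_of_deriv_nonpos (convex_Icc 0 1)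
      (fun s _ => (hd s).continuousAt.continuousWithinAt)
      (fun s _ => (hd s).differentiableAt.differentiableWithinAt) fun s _ => ?_
    rw [(hd s).deriv]
    have := hA z hz (NormedSpace.exp ((s : ℂ) • (z • A)) x)
    linarith
  have h := hanti (left_mem_Icc.2 zero_le_one) (right_mem_Icc.2 zero_le_one) zero_le_one
  simp only [Complex.ofReal_one, Complex.ofReal_zero, one_smul, zero_smul, NormedSpace.exp_zero,
    one_apply_eq_self] at h
  exact le_of_sq_le_sq h (norm_nonneg x)

/-- The graph of an operator with numerical range in the sector opposite to `closedCone`, whose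
resolvent set contains the positive real numbers. -/
structure IsSectorialGraph (G : Submodule ℂ (H × H)) : Prop where
  dissip : ∀ p ∈ G, ∀ z ∈ closedCone, (z * inner ℂ p.1 p.2).re ≤ 0
  surj : ∀ μ : ℝ, 0 < μ → ∀ f : H, ∃ x, (x, (μ : ℂ) • x - f) ∈ G
  single : ∀ y, (0, y) ∈ G → y = 0

namespace IsSectorialGraph

variable {G : Submodule ℂ (H × H)}

theorem re_inner_nonpos (h : IsSectorialGraph G) {x y : H} (hxy : (x, y) ∈ G) :
    (inner ℂ x y).re ≤ 0 := by
  simpa using h.dissip _ hxy 1 (by simp [closedCone])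

/-- Dissipativity gives `μ ‖x‖² ≤ Re ⟪x, f⟫`, and Cauchy–Schwarz finishes. This yields both
uniqueness of the resolvent equation and the bound `μ⁻¹` for its solution operator. -/
theorem mul_norm_le (h : IsSectorialGraph G) {μ : ℝ} {x f : H}
    (hx : (x, (μ : ℂ) • x - f) ∈ G) : μ * ‖x‖ ≤ ‖f‖ := by
  have h1 := h.re_inner_nonpos hx
  rw [inner_sub_right, inner_smul_right, inner_self_eq_norm_sq_to_K] at h1
  have h2 : ((μ : ℂ) * ((‖x‖ : ℝ) : ℂ) ^ 2).re = μ * ‖x‖ ^ 2 := by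
    norm_cast
  have h3 : (inner ℂ x f).re ≤ ‖x‖ * ‖f‖ := re_inner_le_norm (𝕜 := ℂ) x f
  rw [Complex.sub_re] at h1
  simp only [Complex.coe_algebraMap] at h1
  rw [h2] at h1
  rcases (norm_nonneg x).eq_or_lt with h0 | h0
  · rw [← h0]; simp
  · nlinarith

theorem eq_of_mem (h : IsSectorialGraph G) {μ : ℝ} (hμ : 0 < μ) {x x' f : H}
    (hx : (x, (μ : ℂ) • x - f) ∈ G) (hx' : (x', (μ : ℂ) • x' - f) ∈ G) : x = x' := by
  have h1 := G.sub_mem hx hx'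
  have h2 : (x - x', (μ : ℂ) • (x - x') - 0) ∈ G := by
    convert h1 using 1
    simp [smul_sub]
  have h3 := h.mul_norm_le h2
  rw [norm_zero] at h3
  have h4 : ‖x - x'‖ = 0 := le_antisymm (by nlinarith) (norm_nonneg _)
  exact sub_eq_zero.1 (norm_eq_zero.1 h4)

theorem exists_resolvent (h : IsSectorialGraph G) {μ : ℝ} (hμ : 0 < μ) :
    ∃ R : H →L[ℂ] H, ∀ f, (R f, (μ : ℂ) • R f - f) ∈ G := by
  choose R hR using h.surj μ hμ
  let T : H →ₗ[ℂ] H :=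
    { toFun := R
      map_add' := fun f g => h.eq_of_mem hμ (hR _) (by
        convert G.add_mem (hR f) (hR g) using 1
        simp only [Prod.mk_add_mk, smul_add, Prod.mk.injEq, true_and]
        abel)
      map_smul' := fun k f => h.eq_of_mem hμ (hR _) (by
        convert G.smul_mem k (hR f) using 1
        simp only [Prod.smul_mk, smul_sub, RingHom.id_apply, smul_comm k]) }
  refine ⟨T.mkContinuous μ⁻¹ fun f => ?_, hR⟩
  rw [le_inv_mul_iff₀ hμ]
  exact h.mul_norm_le (hR f)

/-- The resolvent `(n + 1 - T)⁻¹`. -/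
noncomputable def resolvent (h : IsSectorialGraph G) (n : ℕ) : H →L[ℂ] H :=
  (h.exists_resolvent (μ := n + 1) (by positivity)).choose

theorem resolvent_mem (h : IsSectorialGraph G) (n : ℕ) (f : H) :
    (h.resolvent n f, ((n : ℂ) + 1) • h.resolvent n f - f) ∈ G := by
  have := (h.exists_resolvent (μ := n + 1) (by positivity)).choose_spec f
  simpa [resolvent] using this

theorem resolvent_eq (h : IsSectorialGraph G) {n : ℕ} {x f : H}
    (hx : (x, ((n : ℂ) + 1) • x - f) ∈ G) : h.resolvent n f = x := by
  refine h.eq_of_mem (μ := n + 1) (f := f) (by positivity) ?_ ?_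
  · simpa using h.resolvent_mem n f
  · simpa using hx

theorem norm_resolvent_le (h : IsSectorialGraph G) (n : ℕ) (f : H) :
    ((n : ℝ) + 1) * ‖h.resolvent n f‖ ≤ ‖f‖ :=
  h.mul_norm_le (μ := n + 1) (by simpa using h.resolvent_mem n f)

theorem resolvent_identity (h : IsSectorialGraph G) (m n : ℕ) (f : H) :
    h.resolvent n f = h.resolvent m f + ((m : ℂ) - n) • h.resolvent m (h.resolvent n f) := by
  rw [← map_smul, ← map_add]
  refine (h.resolvent_eq ?_).symm
  convert h.resolvent_mem n f using 2
  module

/-- The resolvent identity written in both orders; for `m ≠ n` the factor `m - n` cancels. -/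
theorem commute_resolvent (h : IsSectorialGraph G) (m n : ℕ) :
    Commute (h.resolvent m) (h.resolvent n) := by
  rcases eq_or_ne m n with rfl | hmn
  · exact Commute.refl _
  ext f
  have h1 := h.resolvent_identity m n f
  have h2 := h.resolvent_identity n m f
  have h3 : ((m : ℂ) - n) • (h.resolvent m (h.resolvent n f)) =
      ((m : ℂ) - n) • (h.resolvent n (h.resolvent m f)) := by
    have e1 : ((m : ℂ) - n) • (h.resolvent m (h.resolvent n f)) =
        h.resolvent n f - h.resolvent m f := eq_sub_of_add_eq' h1.symm
    have e2 : ((n : ℂ) - m) • (h.resolvent n (h.resolvent m f)) =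
        h.resolvent m f - h.resolvent n f := eq_sub_of_add_eq' h2.symm
    rw [e1, ← neg_sub (n : ℂ) m, neg_smul, e2, neg_sub]
  exact smul_right_injective H (sub_ne_zero.2 (Nat.cast_injective.ne hmn)) h3

/-- The Yosida approximations `(n + 1) T (n + 1 - T)⁻¹`. -/
noncomputable def yosida (h : IsSectorialGraph G) (n : ℕ) : H →L[ℂ] H :=
  ((n : ℂ) + 1) • (((n : ℂ) + 1) • h.resolvent n - 1)

theorem yosida_apply (h : IsSectorialGraph G) (n : ℕ) (f : H) :
    h.yosida n f = ((n : ℂ) + 1) • (((n : ℂ) + 1) • h.resolvent n f - f) := by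
  simp [yosida]

theorem mem_yosida (h : IsSectorialGraph G) (n : ℕ) (f : H) :
    (((n : ℂ) + 1) • h.resolvent n f, h.yosida n f) ∈ G := by
  rw [yosida_apply]
  exact G.smul_mem ((n : ℂ) + 1) (h.resolvent_mem n f)

/-- Write `f = J f - (n + 1)⁻¹ A f`, with `A` the Yosida approximation and `J = (n + 1) (n + 1 -
T)⁻¹`. The pair `(J f, A f)` lies in `G`, and the correction `-(n + 1)⁻¹ ‖A f‖²` is real and
nonpositive, so multiplying by `z` with `Re z ≥ 0` keeps the sign. -/
theorem yosida_dissip (h : IsSectorialGraph G) (n : ℕ) {z : ℂ} (hz : z ∈ closedCone) (f : H) :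
    (z * inner ℂ f (h.yosida n f)).re ≤ 0 := by
  have h1 := h.dissip _ (h.mem_yosida n f) z hz
  have hn : ((n : ℂ) + 1) ≠ 0 := by exact_mod_cast n.succ_ne_zero
  have hf : f = ((n : ℂ) + 1) • h.resolvent n f - ((n : ℂ) + 1)⁻¹ • h.yosida n f := by
    rw [yosida_apply, smul_smul, inv_mul_cancel₀ hn, one_smul]
    abel
  have h2 : inner ℂ f (h.yosida n f) = inner ℂ (((n : ℂ) + 1) • h.resolvent n f) (h.yosida n f) -
      (((((n : ℝ) + 1)⁻¹ * ‖h.yosida n f‖ ^ 2 : ℝ)) : ℂ) := by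
    refine (congrArg (fun v => inner ℂ v (h.yosida n f)) hf).trans ?_
    rw [inner_sub_left, inner_smul_left (h.yosida n f), inner_self_eq_norm_sq_to_K]
    congr 1
    simp
  rw [h2, mul_sub, Complex.sub_re, Complex.re_mul_ofReal]
  have hz0 : 0 ≤ z.re := (abs_nonneg _).trans hz
  have : 0 ≤ z.re * (((n : ℝ) + 1)⁻¹ * ‖h.yosida n f‖ ^ 2) := by positivity
  linarith

/-- Density of the domain comes for free: solve `x - T x = f`. If `f` is orthogonal to the domain,
then `Re ⟪x, T x⟫ = ‖x‖²` is nonpositive, so `x = 0`, and single-valuedness gives `f = 0`. -/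
theorem eq_zero_of_forall_inner (h : IsSectorialGraph G) {f : H}
    (hf : ∀ x y, (x, y) ∈ G → inner ℂ x f = 0) : f = 0 := by
  obtain ⟨x, hx⟩ := h.surj 1 one_pos f
  have h1 := h.re_inner_nonpos hx
  rw [inner_sub_right, hf _ _ hx, inner_smul_right, inner_self_eq_norm_sq_to_K] at h1
  have h2 : ‖x‖ ^ 2 ≤ 0 := by
    have e : (((‖x‖ : ℝ) : ℂ) ^ 2).re = ‖x‖ ^ 2 := by norm_cast
    simpa [e] using h1
  have h3 : x = 0 := by
    rw [← norm_eq_zero]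
    nlinarith [norm_nonneg x]
  subst h3
  have h4 := h.single _ hx
  simpa using h4

theorem norm_smul_resolvent_le (h : IsSectorialGraph G) (n : ℕ) (f : H) :
    ‖((n : ℂ) + 1) • h.resolvent n f‖ ≤ ‖f‖ := by
  refine le_of_eq_of_le ?_ (h.norm_resolvent_le n f)
  rw [norm_smul]
  congr 1
  have := Complex.norm_natCast (n + 1)
  push_cast at this
  exact this

theorem resolvent_of_mem (h : IsSectorialGraph G) {x y : H} (hxy : (x, y) ∈ G) (n : ℕ) :
    ((n : ℂ) + 1) • h.resolvent n x - x = h.resolvent n y := by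
  rw [sub_eq_iff_eq_add, ← sub_eq_iff_eq_add', ← map_smul, ← map_sub]
  refine h.resolvent_eq ?_
  simpa using hxy

variable [CompleteSpace H]

theorem dense_domain (h : IsSectorialGraph G) : Dense {x : H | ∃ y, (x, y) ∈ G} := by
  have hset : {x : H | ∃ y, (x, y) ∈ G} = (G.map (LinearMap.fst ℂ H H) : Set H) := by
    ext x
    simp
  rw [hset, Submodule.dense_iff_topologicalClosure_eq_top,
    Submodule.topologicalClosure_eq_top_iff, Submodule.eq_bot_iff]
  intro f hf
  refine h.eq_zero_of_forall_inner fun x y hxy => ?_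
  exact (Submodule.mem_orthogonal _ _).1 hf x ⟨(x, y), hxy, rfl⟩

/-- On the domain the error is the resolvent applied to `T x`, which is `O(1 / n)`; contractivity
and density extend this to all `f`. -/
theorem tendsto_smul_resolvent (h : IsSectorialGraph G) (f : H) :
    Tendsto (fun n : ℕ => ((n : ℂ) + 1) • h.resolvent n f) atTop (𝓝 f) := by
  rw [Metric.tendsto_atTop]
  intro ε hε
  obtain ⟨x, ⟨y, hxy⟩, hx⟩ := h.dense_domain.exists_dist_lt f (ε := ε / 4) (by linarith)
  obtain ⟨N, hN⟩ := exists_nat_gt (‖y‖ / (ε / 2))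
  refine ⟨N, fun n hn => ?_⟩
  have h1 : ((n : ℂ) + 1) • h.resolvent n f - f =
      ((n : ℂ) + 1) • h.resolvent n (f - x) - (f - x) + h.resolvent n y := by
    rw [← h.resolvent_of_mem hxy n, map_sub, smul_sub]
    abel
  have h2 := h.norm_smul_resolvent_le n (f - x)
  have h3 := h.norm_resolvent_le n y
  have h4 : ‖h.resolvent n y‖ < ε / 2 := by
    rw [div_lt_iff₀ (by positivity)] at hN
    have h5 : (N : ℝ) ≤ n := by exact_mod_cast hn
    have h6 : ‖y‖ < ((n : ℝ) + 1) * (ε / 2) := by nlinarith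
    have h7 : (0 : ℝ) < (n : ℝ) + 1 := by positivity
    exact lt_of_mul_lt_mul_left (h3.trans_lt h6) h7.le
  rw [dist_eq_norm] at hx ⊢
  rw [h1]
  have h5 := norm_add_le (((n : ℂ) + 1) • h.resolvent n (f - x) - (f - x)) (h.resolvent n y)
  have h6 := norm_sub_le (((n : ℂ) + 1) • h.resolvent n (f - x)) (f - x)
  linarith

theorem tendsto_yosida (h : IsSectorialGraph G) {x y : H} (hxy : (x, y) ∈ G) :
    Tendsto (fun n => h.yosida n x) atTop (𝓝 y) :=
  (h.tendsto_smul_resolvent y).congr fun n => by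
    rw [yosida_apply, h.resolvent_of_mem hxy]

theorem isGeneratingSequence (h : IsSectorialGraph G) : IsGeneratingSequence h.yosida where
  comm m n := by
    have h1 := h.commute_resolvent m n
    have h2 : Commute (((m : ℂ) + 1) • h.resolvent m - 1) (((n : ℂ) + 1) • h.resolvent n - 1) :=
      (((h1.smul_left _).smul_right _).sub_left (Commute.one_left _)).sub_right
        (Commute.one_right _)
    exact (h2.smul_left _).smul_right _
  contr n _ hz := norm_exp_smul_le_one (fun _ hw x => h.yosida_dissip n hw x) hz
  dense := h.dense_domain.mono <| by
    rintro x ⟨y, hy⟩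
    exact ⟨y, h.tendsto_yosida hy⟩

/-- The graph `G` is the graph of the generator of the limit semigroup. -/
theorem mem_iff_tendsto (h : IsSectorialGraph G) (x y : H) :
    (x, y) ∈ G ↔ Tendsto (fun t : ℝ => ((t⁻¹ : ℝ) : ℂ) •
      (h.isGeneratingSequence.limit (t : ℂ) x - x)) (𝓝[>] 0) (𝓝 y) := by
  refine ⟨fun hxy => h.isGeneratingSequence.tendsto_generator (h.tendsto_yosida hxy),
    fun hxy => ?_⟩
  -- Maximality: `x'` in the domain solves `x' - T x' = x - y`, so the generator fixes `x - x'`. It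
  -- is dissipative because the semigroup is contractive, hence `‖x - x'‖² ≤ 0`.
  obtain ⟨x', hx'⟩ := h.surj 1 one_pos (x - y)
  have h1 := h.isGeneratingSequence.tendsto_generator (h.tendsto_yosida hx')
  have h2 := (hxy.sub h1).inner (𝕜 := ℂ) (tendsto_const_nhds (x := x - x'))
  have h3 : (inner ℂ (y - (((1 : ℝ) : ℂ) • x' - (x - y))) (x - x')).re ≤ 0 := by
    refine le_of_tendsto ((Complex.continuous_re.tendsto _).comp h2) ?_
    filter_upwards [self_mem_nhdsWithin] with t ht
    rw [mem_Ioi] at ht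
    rw [Function.comp_apply, ← smul_sub, sub_sub_sub_comm, ← map_sub, inner_smul_left,
      Complex.conj_ofReal, Complex.re_ofReal_mul, inner_sub_left, inner_self_eq_norm_sq_to_K]
    have h4 : (inner ℂ (h.isGeneratingSequence.limit (t : ℂ) (x - x')) (x - x')).re ≤
        ‖x - x'‖ ^ 2 := by
      refine (re_inner_le_norm (𝕜 := ℂ) _ _).trans ?_
      rw [sq]
      gcongr
      simpa using ContinuousLinearMap.le_of_opNorm_le _
        (h.isGeneratingSequence.norm_limit_le (ofReal_mem_closedCone ht.le)) (x - x')
    have e : (((‖x - x'‖ : ℝ) : ℂ) ^ 2).re = ‖x - x'‖ ^ 2 := by norm_cast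
    rw [Complex.sub_re]
    refine mul_nonpos_of_nonneg_of_nonpos (inv_nonneg.2 ht.le) ?_
    simp only [Complex.coe_algebraMap, e]
    linarith
  have h5 : y - (((1 : ℝ) : ℂ) • x' - (x - y)) = x - x' := by
    rw [Complex.ofReal_one, one_smul]; abel
  rw [h5, inner_self_eq_norm_sq_to_K] at h3
  have e : (((‖x - x'‖ : ℝ) : ℂ) ^ 2).re = ‖x - x'‖ ^ 2 := by norm_cast
  simp only [Complex.coe_algebraMap, e] at h3
  have h6 : x = x' := by
    rw [← sub_eq_zero, ← norm_eq_zero]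
    nlinarith [norm_nonneg (x - x')]
  subst h6
  simpa using hx'

end IsSectorialGraph

/-- A shift of the generator by `κ` multiplies the semigroup by `e^{κ z}`. -/
theorem isAnalyticSemigroup_exp_smul {X : Type*} [NormedAddCommGroup X] [NormedSpace ℂ X] {δ : ℝ}
    {S : ℂ → X →L[ℂ] X} (hS : IsAnalyticSemigroup δ S) (κ : ℂ) :
    IsAnalyticSemigroup δ fun z => Complex.exp (κ * z) • S z where
  pos := hS.pos
  le_pi_div_two := hS.le_pi_div_two
  analytic := by
    refine AnalyticOnNhd.smul (fun z _ => ?_) hS.analytic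
    exact (analyticAt_const.mul analyticAt_id).cexp
  map_add z hz w hw := by
    rw [hS.map_add z hz w hw, mul_add, Complex.exp_add]
    ext x
    simp [smul_smul, mul_comm]
  map_zero := by simp [hS.map_zero]
  tendsto_zero x := by
    have h : Tendsto (fun z : ℂ => Complex.exp (κ * z)) (𝓝[sector δ] 0) (𝓝 1) := by
      have : Continuous fun z : ℂ => Complex.exp (κ * z) := by fun_prop
      simpa using (this.tendsto 0).mono_left nhdsWithin_le_nhds
    simpa using h.smul (hS.tendsto_zero x)

theorem tendsto_generator_exp_smul {X : Type*} [NormedAddCommGroup X] [NormedSpace ℂ X]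
    {S : ℂ → X →L[ℂ] X} (κ : ℂ) {x y : X}
    (h : Tendsto (fun t : ℝ => ((t⁻¹ : ℝ) : ℂ) • (S (t : ℂ) x - x)) (𝓝[>] 0) (𝓝 y)) :
    Tendsto (fun t : ℝ => ((t⁻¹ : ℝ) : ℂ) • ((Complex.exp (κ * t) • S (t : ℂ)) x - x)) (𝓝[>] 0)
      (𝓝 (y + κ • x)) := by
  have h1 : HasDerivAt (fun t : ℝ => Complex.exp (κ * t)) κ 0 := by
    have h0 : HasDerivAt (fun z : ℂ => Complex.exp (κ * z)) κ ((0 : ℝ) : ℂ) := by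
      simpa using ((hasDerivAt_id (((0 : ℝ) : ℂ))).const_mul κ).cexp
    exact h0.comp_ofReal
  have h2 : Tendsto (fun t : ℝ => ((t⁻¹ : ℝ) : ℂ) * (Complex.exp (κ * t) - 1)) (𝓝[>] 0) (𝓝 κ) := by
    have := (hasDerivAt_iff_tendsto_slope_zero.1 h1).mono_left
      (nhdsWithin_mono 0 fun t (ht : t ∈ Ioi 0) => ne_of_gt ht)
    simpa using this
  have h3 : Tendsto (fun t : ℝ => Complex.exp (κ * t)) (𝓝[>] 0) (𝓝 1) := by
    simpa using h1.continuousAt.tendsto.mono_left nhdsWithin_le_nhds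
  have h4 := (h3.smul h).add (h2.smul_const x)
  rw [one_smul] at h4
  refine h4.congr fun t => ?_
  rw [_root_.smul_apply]
  module

/-- If a shift of the closed operator `T` is sectorial, then `T` generates an analytic
semigroup. -/
theorem generatesAnalyticSemigroup_of_shift [CompleteSpace H] {T : H →ₗ.[ℂ] H}
    {G : Submodule ℂ (H × H)} (hG : IsSectorialGraph G) (κ : ℂ)
    (hT : ∀ x y, (x, y) ∈ T.graph ↔ (x, y - κ • x) ∈ G) :
    GeneratesAnalyticSemigroup T := by
  refine ⟨Real.pi / 4, fun z => Complex.exp (κ * z) • hG.isGeneratingSequence.limit z,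
    isAnalyticSemigroup_exp_smul hG.isGeneratingSequence.isAnalyticSemigroup κ, ?_⟩
  refine LinearPMap.eq_of_eq_graph ?_
  ext ⟨x, y⟩
  rw [mem_graph_generator, hT, hG.mem_iff_tendsto]
  constructor
  · intro h
    -- Twisting by `e^{-κ t}` recovers the unshifted semigroup.
    have h1 := tendsto_generator_exp_smul
      (S := fun z => Complex.exp (κ * z) • hG.isGeneratingSequence.limit z) (-κ) h
    rw [neg_smul, ← sub_eq_add_neg] at h1
    refine h1.congr fun t => ?_
    rw [smul_smul, ← Complex.exp_add, neg_mul, neg_add_cancel, Complex.exp_zero, one_smul]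
  · intro h
    have h1 := tendsto_generator_exp_smul (S := hG.isGeneratingSequence.limit) κ h
    rwa [sub_add_cancel] at h1

end Hilbert

/-! ### Weak derivatives of locally integrable functions -/

/-- `f'` is the weak derivative of `f : ℝ → ℂ`. -/
def HasWeakDeriv (f f' : ℝ → ℂ) : Prop :=
  ∀ φ : ℝ → ℝ, ContDiff ℝ ∞ φ → HasCompactSupport φ → ∫ x, deriv φ x • f x = - ∫ x, φ x • f' x

theorem HasWeakDeriv.conj {f f' : ℝ → ℂ} (h : HasWeakDeriv f f') :
    HasWeakDeriv (fun x => starRingEnd ℂ (f x)) (fun x => starRingEnd ℂ (f' x)) := by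
  intro φ hφ hc
  have e : ∀ (g : ℝ → ℝ) (k : ℝ → ℂ),
      ∫ x, g x • starRingEnd ℂ (k x) = starRingEnd ℂ (∫ x, g x • k x) := by
    intro g k
    rw [← integral_conj]
    simp
  rw [e, e, h φ hφ hc, map_neg]

theorem HasWeakDeriv.smul {f f' : ℝ → ℂ} (h : HasWeakDeriv f f') (hf : LocallyIntegrable f)
    (hf' : LocallyIntegrable f') {g : ℝ → ℝ} (hg : ContDiff ℝ ∞ g) :
    HasWeakDeriv (fun x => g x • f x) (fun x => deriv g x • f x + g x • f' x) := by
  intro φ hφ hc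
  have hg' : Continuous (deriv g) := hg.continuous_deriv (by simp)
  have hφ' : Continuous (deriv φ) := hφ.continuous_deriv (by simp)
  have hd : ∀ x, deriv (fun x => g x * φ x) x = deriv g x * φ x + g x * deriv φ x := fun x =>
    deriv_fun_mul (hg.differentiable (by simp) x) (hφ.differentiable (by simp) x)
  have h1 := h (fun x => g x * φ x) (hg.mul hφ) hc.mul_left
  simp only [hd] at h1
  have i1 : Integrable fun x => (deriv g x * φ x) • f x :=
    hf.integrable_smul_left_of_hasCompactSupport (hg'.mul hφ.continuous) hc.mul_left
  have i2 : Integrable fun x => (g x * deriv φ x) • f x :=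
    hf.integrable_smul_left_of_hasCompactSupport (hg.continuous.mul hφ') hc.deriv.mul_left
  have i3 : Integrable fun x => (g x * φ x) • f' x :=
    hf'.integrable_smul_left_of_hasCompactSupport (hg.continuous.mul hφ.continuous) hc.mul_left
  simp only [add_smul] at h1
  rw [integral_add i1 i2] at h1
  have e1 : ∫ x, φ x • (deriv g x • f x + g x • f' x) =
      (∫ x, (deriv g x * φ x) • f x) + ∫ x, (g x * φ x) • f' x := by
    rw [← integral_add i1 i3]
    refine integral_congr_ae (Eventually.of_forall fun x => ?_)
    simp only [Complex.real_smul, Complex.ofReal_mul]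
    ring
  have e2 : ∫ x, deriv φ x • g x • f x = ∫ x, (g x * deriv φ x) • f x := by
    refine integral_congr_ae (Eventually.of_forall fun x => ?_)
    simp only [Complex.real_smul, Complex.ofReal_mul]
    ring
  rw [e1, e2, neg_add, ← h1]
  abel

/-- A smooth function which is `1` on `[-R, R]` and has compact support. -/
theorem exists_cutoff {R : ℝ} (hR : 0 < R) : ∃ χ : ℝ → ℝ, ContDiff ℝ ∞ χ ∧ HasCompactSupport χ ∧
    ∀ x, |x| < R → χ x = 1 := by
  let B : ContDiffBump (0 : ℝ) := ⟨R, 2 * R, hR, by linarith⟩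
  exact ⟨B, B.contDiff, B.hasCompactSupport, fun x hx => B.one_of_mem_closedBall (by
    simpa using hx.le)⟩

/-- For compactly supported functions, weak derivatives may be tested against arbitrary smooth
functions. -/
theorem HasWeakDeriv.integral_deriv_smul {f f' : ℝ → ℂ} (h : HasWeakDeriv f f') {R : ℝ}
    (hf : ∀ x, R < |x| → f x = 0) (hf' : ∀ x, R < |x| → f' x = 0) {Θ : ℝ → ℝ}
    (hΘ : ContDiff ℝ ∞ Θ) : ∫ x, deriv Θ x • f x = - ∫ x, Θ x • f' x := by
  obtain ⟨χ, hχ, hχc, hχ1⟩ := exists_cutoff (R := |R| + 1) (by positivity)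
  have hlt : ∀ x, ¬ R < |x| → |x| < |R| + 1 := fun x hx => by
    have := le_abs_self R
    linarith
  have h1 := h (fun x => χ x * Θ x) (hχ.mul hΘ) hχc.mul_right
  have e1 : ∫ x, deriv (fun x => χ x * Θ x) x • f x = ∫ x, deriv Θ x • f x := by
    refine integral_congr_ae (Eventually.of_forall fun x => ?_)
    by_cases hx : R < |x|
    · simp [hf x hx]
    · have he : (fun x => χ x * Θ x) =ᶠ[𝓝 x] Θ := by
        filter_upwards [(isOpen_lt continuous_abs continuous_const).mem_nhds (hlt x hx)] with y hy
        rw [hχ1 y hy, one_mul]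
      simp only [he.deriv_eq]
  have e2 : ∫ x, (χ x * Θ x) • f' x = ∫ x, Θ x • f' x := by
    refine integral_congr_ae (Eventually.of_forall fun x => ?_)
    by_cases hx : R < |x|
    · simp [hf' x hx]
    · simp only [hχ1 x (hlt x hx), one_mul]
  rw [← e1, h1, e2]

/-- Fubini on the half-plane `x ≤ y`. -/
theorem integral_integral_Iic_mul {F G : ℝ → ℂ} (hF : Integrable F) (hG : Integrable G) :
    ∫ y, (∫ x in Iic y, F x) * G y = ∫ x, F x * ∫ y in Ici x, G y := by
  have hK : Integrable (fun p : ℝ × ℝ => {p : ℝ × ℝ | p.2 ≤ p.1}.indicator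
      (fun p => G p.1 * F p.2) p) (volume.prod volume) :=
    (hG.mul_prod hF).indicator (measurableSet_le measurable_snd measurable_fst)
  have h := integral_integral_swap
    (f := fun y x => {p : ℝ × ℝ | p.2 ≤ p.1}.indicator (fun p => G p.1 * F p.2) (y, x)) hK
  have e1 : ∀ y, (∫ x in Iic y, F x) * G y =
      ∫ x, {p : ℝ × ℝ | p.2 ≤ p.1}.indicator (fun p => G p.1 * F p.2) (y, x) := by
    intro y
    rw [mul_comm, ← integral_const_mul, ← integral_indicator measurableSet_Iic]
    rfl
  have e2 : ∀ x, F x * (∫ y in Ici x, G y) =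
      ∫ y, {p : ℝ × ℝ | p.2 ≤ p.1}.indicator (fun p => G p.1 * F p.2) (y, x) := by
    intro x
    rw [mul_comm, ← integral_mul_const, ← integral_indicator measurableSet_Ici]
    rfl
  simp only [e1, e2, h]

/-- Provides a smooth function with prescribed derivative `-ψ`. It need not have compact support,
which is why `HasWeakDeriv.integral_deriv_smul` admits arbitrary smooth functions. -/
theorem contDiff_integral_Ici {ψ : ℝ → ℝ} (hψ : ContDiff ℝ ∞ ψ) (hi : Integrable ψ) :
    ContDiff ℝ ∞ (fun x => ∫ y in Ici x, ψ y) ∧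
      ∀ x, deriv (fun x => ∫ y in Ici x, ψ y) x = -ψ x := by
  have e : (fun x => ∫ y in Ici x, ψ y) = fun x => (∫ y in Ioi 0, ψ y) - ∫ y in (0 : ℝ)..x, ψ y := by
    ext x
    rw [integral_Ici_eq_integral_Ioi, eq_sub_iff_add_eq, add_comm]
    exact intervalIntegral.integral_interval_add_Ioi hi.integrableOn hi.integrableOn
  have hd : ∀ x, HasDerivAt (fun x => ∫ y in Ici x, ψ y) (-ψ x) x := by
    intro x
    rw [e]
    have := intervalIntegral.integral_hasDerivAt_right (hi.intervalIntegrable (a := 0) (b := x))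
      hψ.continuous.stronglyMeasurable.stronglyMeasurableAtFilter hψ.continuous.continuousAt
    simpa using this.const_sub (∫ y in Ioi 0, ψ y)
  refine ⟨?_, fun x => (hd x).deriv⟩
  rw [contDiff_infty_iff_deriv]
  refine ⟨fun x => (hd x).differentiableAt, ?_⟩
  rw [funext fun x => (hd x).deriv]
  exact hψ.neg

/-- A compactly supported function is the primitive of its weak derivative. -/
theorem HasWeakDeriv.ae_eq_integral {f f' : ℝ → ℂ} (h : HasWeakDeriv f f')
    (hi : Integrable f) (hi' : Integrable f') {R : ℝ}
    (hf : ∀ x, R < |x| → f x = 0) (hf' : ∀ x, R < |x| → f' x = 0) :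
    f =ᵐ[volume] fun y => ∫ x in Iic y, f' x := by
  have hcont : Continuous fun y => ∫ x in Iic y, f' x := by
    have e : (fun y => ∫ x in Iic y, f' x) =
        fun y => (∫ x in Iic 0, f' x) + ∫ x in (0 : ℝ)..y, f' x := by
      ext y
      rw [intervalIntegral.integral_Iic_sub_Iic hi'.integrableOn hi'.integrableOn |>.symm]
      abel
    rw [e]
    exact continuous_const.add (intervalIntegral.continuous_primitive
      (fun a b => hi'.intervalIntegrable) 0)
  refine ae_eq_of_integral_contDiff_smul_eq hi.locallyIntegrable hcont.locallyIntegrable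
    fun ψ hψ hc => ?_
  have hψi : Integrable ψ := hψ.continuous.integrable_of_hasCompactSupport hc
  obtain ⟨hΘ, hΘ'⟩ := contDiff_integral_Ici hψ hψi
  have h1 := h.integral_deriv_smul hf hf' hΘ
  simp only [hΘ', neg_smul, integral_neg, neg_inj] at h1
  have h2 := integral_integral_Iic_mul hi' (hψi.ofReal (𝕜 := ℂ))
  rw [h1]
  have e1 : ∀ x, (∫ y in Ici x, ψ y) • f' x = f' x * ∫ y in Ici x, (ψ y : ℂ) := by
    intro x
    rw [integral_complex_ofReal, Complex.real_smul, mul_comm]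
  have e2 : ∀ y, ψ y • (∫ x in Iic y, f' x) = (∫ x in Iic y, f' x) * (ψ y : ℂ) := fun y => by
    rw [Complex.real_smul, mul_comm]
  simp only [e1, e2]
  exact h2.symm

/-- Since `∫ g' = 0`, the function `g` is minus the tail integral of `g'`, while `f` is the
primitive of `f'`; the identity is then Fubini. -/
theorem HasWeakDeriv.integral_mul_eq_neg {f f' g g' : ℝ → ℂ} (h : HasWeakDeriv f f')
    (k : HasWeakDeriv g g') (hi : Integrable f) (hi' : Integrable f') (ki : Integrable g)
    (ki' : Integrable g') {R : ℝ} (hf : ∀ x, R < |x| → f x = 0) (hf' : ∀ x, R < |x| → f' x = 0)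
    (hg : ∀ x, R < |x| → g x = 0) (hg' : ∀ x, R < |x| → g' x = 0) :
    ∫ x, f x * g' x = - ∫ x, f' x * g x := by
  have h0 : ∫ x, g' x = 0 := by
    have := k.integral_deriv_smul hg hg' (contDiff_const (c := (1 : ℝ)))
    simpa using this.symm
  have e1 : ∫ x, f x * g' x = ∫ y, (∫ x in Iic y, f' x) * g' y := by
    refine integral_congr_ae ?_
    filter_upwards [h.ae_eq_integral hi hi' hf hf'] with x hx
    rw [hx]
  have e2 : ∫ x, f' x * g x = - ∫ x, f' x * ∫ y in Ici x, g' y := by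
    rw [← integral_neg]
    refine integral_congr_ae ?_
    filter_upwards [k.ae_eq_integral ki ki' hg hg'] with x hx
    have := intervalIntegral.integral_Iic_add_Ioi (b := x) (f := g') (μ := volume)
      ki'.integrableOn ki'.integrableOn
    rw [h0] at this
    rw [hx, integral_Ici_eq_integral_Ioi, eq_neg_of_add_eq_zero_left this]
    ring
  rw [e1, e2, neg_neg, integral_integral_Iic_mul hi' ki']

/-! ### The weight -/

/-- The weight `e^{-2 lam ⟨x⟩}`. -/
noncomputable def weight (lam x : ℝ) : ℝ := Real.exp (-2 * lam * √(1 + x ^ 2))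

theorem weight_pos (lam x : ℝ) : 0 < weight lam x := Real.exp_pos _

theorem contDiff_weight (lam : ℝ) : ContDiff ℝ ∞ (weight lam) := by
  unfold weight
  refine Real.contDiff_exp.comp (contDiff_const.mul (ContDiff.sqrt (by fun_prop) fun x => ?_))
  positivity

/-- The factor in front of the weight is bounded in `x`; this keeps the terms produced by
integration by parts inside `L²_lam`. -/
theorem hasDerivAt_weight (lam x : ℝ) :
    HasDerivAt (weight lam) (-2 * lam * (x / √(1 + x ^ 2)) * weight lam x) x := by
  have h1 : HasDerivAt (fun x : ℝ => 1 + x ^ 2) (2 * x) x := by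
    simpa using (hasDerivAt_pow 2 x).const_add 1
  have h2 := ((h1.sqrt (by positivity)).const_mul (-2 * lam)).exp
  refine h2.congr_deriv ?_
  unfold weight
  field_simp

theorem integrable_weightMeasure_iff {lam : ℝ} {f : ℝ → ℂ} :
    Integrable f (weightMeasure lam) ↔ Integrable fun x => weight lam x • f x := by
  rw [weightMeasure, integrable_withDensity_iff_integrable_smul' (by fun_prop)
      (Eventually.of_forall fun x => ENNReal.ofReal_lt_top)]
  simp only [ENNReal.toReal_ofReal (Real.exp_pos _).le]
  rfl

theorem integral_weightMeasure {lam : ℝ} (f : ℝ → ℂ) :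
    ∫ x, f x ∂(weightMeasure lam) = ∫ x, weight lam x • f x := by
  rw [weightMeasure, integral_withDensity_eq_integral_toReal_smul (by fun_prop)
      (Eventually.of_forall fun x => ENNReal.ofReal_lt_top)]
  simp only [ENNReal.toReal_ofReal (Real.exp_pos _).le]
  rfl

theorem ae_weightMeasure_iff {lam : ℝ} {P : ℝ → Prop} :
    (∀ᵐ x ∂(weightMeasure lam), P x) ↔ ∀ᵐ x, P x :=
  ⟨fun h => (volume_absolutelyContinuous_weightMeasure lam).ae_le h,
    fun h => (weightMeasure_absolutelyContinuous_volume lam).ae_le h⟩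

/-- The integrand of the inner product of `L²_lam(ℝ)`. -/
noncomputable def pairing {lam : ℝ} (u v : WeightedL2 lam) (x : ℝ) : ℂ :=
  weight lam x • (starRingEnd ℂ (u x) * v x)

theorem integrable_pairing {lam : ℝ} (u v : WeightedL2 lam) : Integrable (pairing u v) := by
  refine integrable_weightMeasure_iff.1 ?_
  refine (L2.integrable_inner (𝕜 := ℂ) u v).congr (Eventually.of_forall fun x => ?_)
  simp [RCLike.inner_apply, mul_comm]

theorem inner_eq_integral_pairing {lam : ℝ} (u v : WeightedL2 lam) :
    inner ℂ u v = ∫ x, pairing u v x := by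
  rw [L2.inner_def, integral_weightMeasure]
  simp only [pairing, RCLike.inner_apply, mul_comm]

/-! ### Multiplication by bounded continuous functions -/

/-- Bounded continuous real functions on the line. -/
structure IsBoundedContinuous (g : ℝ → ℝ) : Prop where
  continuous : Continuous g
  bounded : ∃ C, ∀ x, |g x| ≤ C

theorem IsTotallyBounded.isBoundedContinuous {f : ℝ → ℝ} (hf : IsTotallyBounded f) :
    IsBoundedContinuous f :=
  ⟨hf.contDiff.continuous, by simpa using hf.bounded 0⟩

theorem IsTotallyBounded.deriv {f : ℝ → ℝ} (hf : IsTotallyBounded f) :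
    IsBoundedContinuous (deriv f) :=
  ⟨hf.contDiff.continuous_deriv (by simp), by simpa using hf.bounded 1⟩

namespace IsBoundedContinuous

variable {g k : ℝ → ℝ}

theorem mul (hg : IsBoundedContinuous g) (hk : IsBoundedContinuous k) :
    IsBoundedContinuous fun x => g x * k x := by
  obtain ⟨C, hC⟩ := hg.bounded
  obtain ⟨D, hD⟩ := hk.bounded
  refine ⟨hg.continuous.mul hk.continuous, C * D, fun x => ?_⟩
  rw [abs_mul]
  exact mul_le_mul (hC x) (hD x) (abs_nonneg _) ((abs_nonneg _).trans (hC x))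

theorem add (hg : IsBoundedContinuous g) (hk : IsBoundedContinuous k) :
    IsBoundedContinuous fun x => g x + k x := by
  obtain ⟨C, hC⟩ := hg.bounded
  obtain ⟨D, hD⟩ := hk.bounded
  exact ⟨hg.continuous.add hk.continuous, C + D, fun x =>
    (abs_add_le _ _).trans (add_le_add (hC x) (hD x))⟩

theorem const (c : ℝ) : IsBoundedContinuous fun _ => c :=
  ⟨continuous_const, |c|, fun _ => le_rfl⟩

theorem sub (hg : IsBoundedContinuous g) (hk : IsBoundedContinuous k) :
    IsBoundedContinuous fun x => g x - k x := by
  have := hg.add ((const (-1)).mul hk)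
  simpa [sub_eq_add_neg] using this

theorem inv (hg : IsBoundedContinuous g) {ε : ℝ} (hε : 0 < ε) (h : ∀ x, ε ≤ g x) :
    IsBoundedContinuous fun x => (g x)⁻¹ := by
  refine ⟨hg.continuous.inv₀ fun x => (hε.trans_le (h x)).ne', ε⁻¹, fun x => ?_⟩
  rw [abs_of_nonneg (inv_nonneg.2 (hε.le.trans (h x)))]
  exact inv_anti₀ hε (h x)

theorem integrable_smul {E : Type*} [NormedAddCommGroup E] [NormedSpace ℝ E]
    (hg : IsBoundedContinuous g) {f : ℝ → E} (hf : Integrable f) :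
    Integrable fun x => g x • f x := by
  obtain ⟨C, hC⟩ := hg.bounded
  exact hf.bdd_smul C hg.continuous.aestronglyMeasurable (Eventually.of_forall hC)

theorem memLp (hg : IsBoundedContinuous g) {lam : ℝ} (u : WeightedL2 lam) :
    MemLp (fun x => g x • u x) 2 (weightMeasure lam) := by
  obtain ⟨C, hC⟩ := hg.bounded
  refine (Lp.memLp u).of_le_mul (c := C)
    (hg.continuous.aestronglyMeasurable.smul (Lp.aestronglyMeasurable u))
    (Eventually.of_forall fun x => ?_)
  rw [norm_smul]
  exact mul_le_mul_of_nonneg_right (hC x) (norm_nonneg _)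

theorem exists_mulCLM (hg : IsBoundedContinuous g) (lam : ℝ) :
    ∃ T : WeightedL2 lam →L[ℂ] WeightedL2 lam, ∀ u, T u =ᵐ[volume] fun x => g x • u x := by
  have hae : ∀ u : WeightedL2 lam, (hg.memLp u).toLp (fun x => g x • u x) =ᵐ[volume] fun x => g x • u x :=
    fun u => ae_weightMeasure_iff.1 (hg.memLp u).coeFn_toLp
  let T : WeightedL2 lam →ₗ[ℂ] WeightedL2 lam :=
    { toFun := fun u => (hg.memLp u).toLp fun x => g x • u x
      map_add' := fun u v => by
        refine Lp.ext ?_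
        filter_upwards [(hg.memLp (u + v)).coeFn_toLp, (hg.memLp u).coeFn_toLp,
          (hg.memLp v).coeFn_toLp, Lp.coeFn_add u v,
          Lp.coeFn_add ((hg.memLp u).toLp fun x => g x • u x)
            ((hg.memLp v).toLp fun x => g x • v x)] with x h1 h2 h3 h4 h5
        rw [h1, h5, Pi.add_apply, h2, h3, h4, Pi.add_apply, smul_add]
      map_smul' := fun k u => by
        refine Lp.ext ?_
        filter_upwards [(hg.memLp (k • u)).coeFn_toLp, (hg.memLp u).coeFn_toLp,
          Lp.coeFn_smul k u, 
          Lp.coeFn_smul k ((hg.memLp u).toLp fun x => g x • u x)] with x h1 h2 h3 h4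
        rw [h1, RingHom.id_apply, h4, Pi.smul_apply, h2, h3, Pi.smul_apply, smul_comm] }
  obtain ⟨C, hC⟩ := hg.bounded
  refine ⟨T.mkContinuous C fun u => ?_, hae⟩
  refine Lp.norm_le_mul_norm_of_ae_le_mul ?_
  filter_upwards [(hg.memLp u).coeFn_toLp] with x hx
  change ‖(hg.memLp u).toLp (fun x => g x • u x) x‖ ≤ _
  rw [hx, norm_smul]
  exact mul_le_mul_of_nonneg_right (hC x) (norm_nonneg _)

/-- Multiplication by a bounded continuous function, as a bounded operator on `L²_lam(ℝ)`. -/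
noncomputable def mulCLM (hg : IsBoundedContinuous g) (lam : ℝ) :
    WeightedL2 lam →L[ℂ] WeightedL2 lam :=
  (hg.exists_mulCLM lam).choose

theorem coeFn_mulCLM (hg : IsBoundedContinuous g) {lam : ℝ} (u : WeightedL2 lam) :
    hg.mulCLM lam u =ᵐ[volume] fun x => g x • u x :=
  (hg.exists_mulCLM lam).choose_spec u

theorem inner_mulCLM (hg : IsBoundedContinuous g) {lam : ℝ} (u v : WeightedL2 lam) :
    inner ℂ u (hg.mulCLM lam v) = ∫ x, g x • pairing u v x := by
  rw [inner_eq_integral_pairing]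
  refine integral_congr_ae ?_
  filter_upwards [hg.coeFn_mulCLM v] with x hx
  simp only [pairing, hx, Complex.real_smul]
  ring

theorem inner_mulCLM_self (hg : IsBoundedContinuous g) {lam : ℝ} (u : WeightedL2 lam) :
    inner ℂ u (hg.mulCLM lam u) = ((∫ x, g x * (weight lam x * ‖u x‖ ^ 2) : ℝ) : ℂ) := by
  rw [inner_mulCLM, ← integral_complex_ofReal]
  refine integral_congr_ae (Eventually.of_forall fun x => ?_)
  simp only [pairing, RCLike.conj_mul, Complex.real_smul]
  push_cast
  rfl

end IsBoundedContinuous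

theorem norm_sq_eq_integral {lam : ℝ} (u : WeightedL2 lam) :
    ‖u‖ ^ 2 = ∫ x, weight lam x * ‖u x‖ ^ 2 := by
  have h : ((‖u‖ ^ 2 : ℝ) : ℂ) = ((∫ x, weight lam x * ‖u x‖ ^ 2 : ℝ) : ℂ) := by
    have h1 := inner_self_eq_norm_sq_to_K (𝕜 := ℂ) u
    rw [inner_eq_integral_pairing] at h1
    rw [← integral_complex_ofReal, Complex.ofReal_pow]
    refine h1.symm.trans (integral_congr_ae (Eventually.of_forall fun x => ?_))
    simp only [pairing, RCLike.conj_mul, Complex.real_smul]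
    push_cast
    rfl
  exact_mod_cast h

theorem integrable_weight_mul_norm_sq {lam : ℝ} (u : WeightedL2 lam) :
    Integrable fun x => weight lam x * ‖u x‖ ^ 2 := by
  refine (integrable_pairing u u).norm.congr (Eventually.of_forall fun x => ?_)
  simp only [pairing, RCLike.conj_mul, norm_smul, Real.norm_of_nonneg (weight_pos lam x).le]
  simp

theorem IsBoundedContinuous.le_inner_mulCLM_self {g : ℝ → ℝ} (hg : IsBoundedContinuous g) {ε : ℝ}
    (h : ∀ x, ε ≤ g x) {lam : ℝ} (u : WeightedL2 lam) :
    ε * ‖u‖ ^ 2 ≤ ∫ x, g x * (weight lam x * ‖u x‖ ^ 2) := by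
  rw [norm_sq_eq_integral, ← integral_const_mul]
  refine integral_mono ((integrable_weight_mul_norm_sq u).const_mul ε) ?_ fun x => ?_
  · exact hg.integrable_smul (integrable_weight_mul_norm_sq u)
  · have := weight_pos lam x
    exact mul_le_mul_of_nonneg_right (h x) (by positivity)

theorem IsTotallyBounded.mulOp_eq {f : ℝ → ℝ} (hf : IsTotallyBounded f) {lam : ℝ}
    (u : WeightedL2 lam) : mulOp hf lam u = hf.isBoundedContinuous.mulCLM lam u := by
  refine Lp.ext (ae_weightMeasure_iff.2 ?_)
  filter_upwards [hf.isBoundedContinuous.coeFn_mulCLM u,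
    ae_weightMeasure_iff.1 (hf.memLp u).coeFn_toLp] with x h1 h2
  rw [h1, ← h2]
  rfl

/-! ### Integration by parts in the weighted space -/

theorem HasCompactSupport.exists_radius {f : ℝ → ℝ} (hf : HasCompactSupport f) :
    ∃ R, ∀ x, R < |x| → f x = 0 ∧ deriv f x = 0 := by
  obtain ⟨R, hR⟩ := hf.isCompact.isBounded.subset_closedBall 0
  refine ⟨R, fun x hx => ?_⟩
  have hx' : x ∉ tsupport f := fun h => by
    have := hR h
    rw [mem_closedBall_zero_iff, Real.norm_eq_abs] at this
    exact hx.not_ge this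
  refine ⟨image_eq_zero_of_notMem_tsupport hx', ?_⟩
  by_contra h
  exact hx' (support_deriv_subset h)

/-- Compactly supported integration by parts for `χ p̄` and `χ a w q`. The function `e` is `(a w)' /
w`, and the cutoff in both factors produces `χ²` and its derivative `2 χ χ'`. -/
theorem integral_cutoff_pairing {lam : ℝ} {p p' q q' : WeightedL2 lam} (hp : IsWeakDeriv p p')
    (hq : IsWeakDeriv q q') {a e : ℝ → ℝ} (ha : ContDiff ℝ ∞ a) (ha' : IsBoundedContinuous a)
    (he' : IsBoundedContinuous e)
    (he : ∀ x, deriv (fun x => a x * weight lam x) x = e x * weight lam x) {χ : ℝ → ℝ}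
    (hχ : ContDiff ℝ ∞ χ) (hχc : HasCompactSupport χ) :
    ∫ x, ((χ x ^ 2) • (e x • pairing p q x + a x • pairing p q' x + a x • pairing p' q x) +
      (2 * (χ x * deriv χ x)) • (a x • pairing p q x)) = 0 := by
  obtain ⟨R, hR⟩ := HasCompactSupport.exists_radius hχc
  have hm : ContDiff ℝ ∞ fun x => χ x * (a x * weight lam x) :=
    hχ.mul (ha.mul (contDiff_weight lam))
  have hmc : HasCompactSupport fun x => χ x * (a x * weight lam x) := hχc.mul_right
  have hdm : ∀ x, deriv (fun x => χ x * (a x * weight lam x)) x =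
      deriv χ x * (a x * weight lam x) + χ x * (e x * weight lam x) := fun x => by
    rw [deriv_fun_mul (hχ.differentiable (by simp) x)
      ((ha.mul (contDiff_weight lam)).differentiable (by simp) x), he]
  have hχ' : Continuous (deriv χ) := hχ.continuous_deriv (by simp)
  have hconj : ∀ u : WeightedL2 lam, LocallyIntegrable fun x => starRingEnd ℂ (u x) := by
    intro u x
    obtain ⟨s, hs, hi⟩ := locallyIntegrable_weightedL2 u x
    exact ⟨s, hs, (Complex.conjCLE : ℂ →L[ℝ] ℂ).integrable_comp hi⟩
  have lp := hconj p
  have lp' := hconj p'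
  have lq := locallyIntegrable_weightedL2 q
  have lq' := locallyIntegrable_weightedL2 q'
  have hP := (HasWeakDeriv.conj (f := p) (f' := p') hp).smul lp lp' hχ
  have hQ := HasWeakDeriv.smul (f := q) (f' := q') hq lq lq' hm
  have hbχ : ∀ {k : ℝ → ℝ}, Continuous k → HasCompactSupport k → IsBoundedContinuous k := by
    intro k hk hkc
    obtain ⟨C, hC⟩ := hkc.exists_bound_of_continuous hk
    exact ⟨hk, C, hC⟩
  have b1 := hbχ hχ.continuous hχc
  have b2 := hbχ hχ' hχc.deriv
  have h := hP.integral_mul_eq_neg hQ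
    (lp.integrable_smul_left_of_hasCompactSupport hχ.continuous hχc)
    ((lp.integrable_smul_left_of_hasCompactSupport hχ' hχc.deriv).add
      (lp'.integrable_smul_left_of_hasCompactSupport hχ.continuous hχc))
    (lq.integrable_smul_left_of_hasCompactSupport hm.continuous hmc)
    ((lq.integrable_smul_left_of_hasCompactSupport (hm.continuous_deriv (by simp)) hmc.deriv).add
      (lq'.integrable_smul_left_of_hasCompactSupport hm.continuous hmc)) (R := R)
    (fun x hx => by simp [(hR x hx).1]) (fun x hx => by simp [(hR x hx).1, (hR x hx).2])
    (fun x hx => by simp [(hR x hx).1]) (fun x hx => by simp [hdm, (hR x hx).1, (hR x hx).2])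
  rw [eq_neg_iff_add_eq_zero] at h
  have e1 : ∀ x, (χ x • starRingEnd ℂ (p x)) *
      (deriv (fun x => χ x * (a x * weight lam x)) x • q x + (χ x * (a x * weight lam x)) • q' x) =
      (χ x * deriv χ x) • (a x • pairing p q x) + (χ x * χ x) • (e x • pairing p q x) +
        (χ x * χ x) • (a x • pairing p q' x) := by
    intro x
    simp only [hdm, pairing, Complex.real_smul]
    push_cast
    ring
  have e2 : ∀ x, (deriv χ x • starRingEnd ℂ (p x) + χ x • starRingEnd ℂ (p' x)) *
      ((χ x * (a x * weight lam x)) • q x) =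
      (χ x * deriv χ x) • (a x • pairing p q x) + (χ x * χ x) • (a x • pairing p' q x) := by
    intro x
    simp only [pairing, Complex.real_smul]
    push_cast
    ring
  simp only [e1, e2] at h
  have i1 := (b1.mul b2).integrable_smul (ha'.integrable_smul (integrable_pairing p q))
  have i2 := (b1.mul b1).integrable_smul (he'.integrable_smul (integrable_pairing p q))
  have i3 := (b1.mul b1).integrable_smul (ha'.integrable_smul (integrable_pairing p q'))
  have i4 := (b1.mul b1).integrable_smul (ha'.integrable_smul (integrable_pairing p' q))
  refine Eq.trans (integral_congr_ae (Eventually.of_forall fun x => ?_))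
    ((integral_add ((i1.add i2).add i3) (i1.add i4)).trans h)
  simp only [Pi.add_apply, Complex.real_smul]
  push_cast
  ring

/-- Integration by parts in `L²_lam(ℝ)`. -/
theorem integral_pairing_eq_zero {lam : ℝ} {p p' q q' : WeightedL2 lam} (hp : IsWeakDeriv p p')
    (hq : IsWeakDeriv q q') {a e : ℝ → ℝ} (ha : ContDiff ℝ ∞ a) (ha' : IsBoundedContinuous a)
    (he' : IsBoundedContinuous e)
    (he : ∀ x, deriv (fun x => a x * weight lam x) x = e x * weight lam x) :
    ∫ x, (e x • pairing p q x + a x • pairing p q' x + a x • pairing p' q x) = 0 := by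
  obtain ⟨χ, hχ, hχc, hχ1⟩ := exists_cutoff one_pos
  obtain ⟨C, hC⟩ := hχc.exists_bound_of_continuous hχ.continuous
  have hχ' : Continuous (deriv χ) := hχ.continuous_deriv (by simp)
  obtain ⟨D, hD⟩ := hχc.deriv.exists_bound_of_continuous hχ'
  have hC0 : 0 ≤ C := (norm_nonneg _).trans (hC 0)
  have hD0 : 0 ≤ D := (norm_nonneg _).trans (hD 0)
  set F : ℝ → ℂ := fun x => e x • pairing p q x + a x • pairing p q' x + a x • pairing p' q x
  set G : ℝ → ℂ := fun x => a x • pairing p q x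
  have hF : Integrable F := ((he'.integrable_smul (integrable_pairing p q)).add
    (ha'.integrable_smul (integrable_pairing p q'))).add
      (ha'.integrable_smul (integrable_pairing p' q))
  have hG : Integrable G := ha'.integrable_smul (integrable_pairing p q)
  -- The dilated cutoffs `χ (s n x)` tend to `1` while their derivatives are `O(s n)`, so the cutoff
  -- term disappears in the limit by dominated convergence.
  let s : ℕ → ℝ := fun n => ((n : ℝ) + 1)⁻¹
  have hs : Tendsto s atTop (𝓝 0) := tendsto_one_div_add_atTop_nhds_zero_nat.congr fun n => by
    simp [s]
  have hs0 : ∀ n, 0 < s n := fun n => by positivity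
  have hs1 : ∀ n, s n ≤ 1 := fun n => inv_le_one_of_one_le₀ (by simp)
  have hd : ∀ n x, deriv (fun x => χ (s n * x)) x = s n * deriv χ (s n * x) := fun n x => by
    have := deriv_comp_mul_left (s n) χ x
    simpa using this
  have hzero : ∀ n, ∫ x, ((χ (s n * x) ^ 2) • F x +
      (2 * (χ (s n * x) * (s n * deriv χ (s n * x)))) • G x) = 0 := by
    intro n
    have := integral_cutoff_pairing hp hq ha ha' he' he (χ := fun x => χ (s n * x))
      (hχ.comp (contDiff_const.mul contDiff_id))
      (hχc.comp_homeomorph (Homeomorph.mulLeft₀ (s n) (hs0 n).ne'))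
    simpa only [hd] using this
  refine tendsto_nhds_unique (f := fun _ : ℕ => (0 : ℂ)) (l := atTop) ?_ tendsto_const_nhds
  have hlim := tendsto_integral_of_dominated_convergence (μ := volume) (f := F)
    (F := fun n x => (χ (s n * x) ^ 2) • F x +
      (2 * (χ (s n * x) * (s n * deriv χ (s n * x)))) • G x)
    (fun x => C ^ 2 * ‖F x‖ + 2 * (C * D) * ‖G x‖) ?_
    ((hF.norm.const_mul _).add (hG.norm.const_mul _)) ?_ ?_
  · simpa only [hzero] using hlim
  · intro n
    have c0 : Continuous fun x => s n * x := continuous_const.mul continuous_id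
    have c1 : Continuous fun x => χ (s n * x) ^ 2 := (hχ.continuous.comp c0).pow 2
    have c2 : Continuous fun x => 2 * (χ (s n * x) * (s n * deriv χ (s n * x))) :=
      continuous_const.mul ((hχ.continuous.comp c0).mul (continuous_const.mul (hχ'.comp c0)))
    exact (c1.aestronglyMeasurable.smul hF.1).add (c2.aestronglyMeasurable.smul hG.1)
  · intro n
    refine Eventually.of_forall fun x => (norm_add_le _ _).trans ?_
    rw [norm_smul, norm_smul, norm_pow, norm_mul, norm_mul, norm_mul, Real.norm_ofNat,
      Real.norm_of_nonneg (hs0 n).le]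
    have h1 := hC (s n * x)
    have h2 := hD (s n * x)
    have h3 : s n * ‖deriv χ (s n * x)‖ ≤ D := by
      have := mul_le_mul (hs1 n) h2 (norm_nonneg _) zero_le_one
      linarith
    gcongr
  · refine Eventually.of_forall fun x => ?_
    have hx : Tendsto (fun n => s n * x) atTop (𝓝 0) := by simpa using hs.mul_const x
    have h0 : χ 0 = 1 := hχ1 0 (by simp)
    have t1 : Tendsto (fun n => χ (s n * x)) atTop (𝓝 1) := by
      rw [← h0]; exact (hχ.continuous.tendsto 0).comp hx
    have t2 : Tendsto (fun n => deriv χ (s n * x)) atTop (𝓝 (deriv χ 0)) :=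
      (hχ'.tendsto 0).comp hx
    have := ((t1.pow 2).smul_const (F x)).add
      (((t1.mul (hs.mul t2)).const_mul 2).smul_const (G x))
    simpa using this

/-! ### Abstract elliptic forms -/

section Form

variable {H : Type*} [NormedAddCommGroup H] [InnerProductSpace ℂ H]

theorem norm_le_two_mul_re {z : ℂ} (hz : z ∈ closedCone) : ‖z‖ ≤ 2 * z.re := by
  have h : |z.im| ≤ z.re := hz
  have h1 := Complex.norm_le_abs_re_add_abs_im z
  rw [abs_of_nonneg ((abs_nonneg _).trans h)] at h1
  linarith

/-- The shift which makes the form `-⟪v, A v⟫ + ⟪u, P v⟫ + ⟪u, Q u⟫` sectorial. -/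
noncomputable def formShift (ε : ℝ) (P Q : H →L[ℂ] H) : ℝ := 2 * ‖Q‖ + 2 * ‖P‖ ^ 2 / ε

/-- The leading term is real, so it contributes exactly `-(Re z) r` with `r ≥ ε ‖v‖²`. The other
terms cost a factor `‖z‖ ≤ 2 Re z`, and Young's inequality `2 ‖u‖ ‖P‖ ‖v‖ ≤ ε / 2 ‖v‖² + 2 ‖P‖² / ε
‖u‖²` accounts for the constants in `formShift`. -/
theorem re_mul_form_le {ε : ℝ} (hε : 0 < ε) {A : H →L[ℂ] H}
    (hA : ∀ v, ∃ r : ℝ, inner ℂ v (A v) = r ∧ ε * ‖v‖ ^ 2 ≤ r) (P Q : H →L[ℂ] H) {z : ℂ}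
    (hz : z ∈ closedCone) (u v : H) :
    (z * (-inner ℂ v (A v) + inner ℂ u (P v) + inner ℂ u (Q u) -
      (formShift ε P Q : ℂ) * inner ℂ u u)).re ≤ -(z.re * (ε / 2 * ‖v‖ ^ 2)) := by
  obtain ⟨r, hr, hr'⟩ := hA v
  have hz0 : 0 ≤ z.re := (abs_nonneg _).trans hz
  have key : ∀ y : H, (z * inner ℂ u y).re ≤ 2 * z.re * (‖u‖ * ‖y‖) := fun y =>
    calc (z * inner ℂ u y).re ≤ ‖z * inner ℂ u y‖ := Complex.re_le_norm _
      _ = ‖z‖ * ‖inner ℂ u y‖ := norm_mul _ _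
      _ ≤ 2 * z.re * (‖u‖ * ‖y‖) :=
        mul_le_mul (norm_le_two_mul_re hz) (norm_inner_le_norm u y) (norm_nonneg _) (by linarith)
  have h1 := key (P v)
  have h2 := key (Q u)
  have h3 : ‖u‖ * ‖P v‖ ≤ ‖u‖ * (‖P‖ * ‖v‖) := by gcongr; exact P.le_opNorm v
  have h4 : ‖u‖ * ‖Q u‖ ≤ ‖u‖ * (‖Q‖ * ‖u‖) := by gcongr; exact Q.le_opNorm u
  have h5 : (z * (-inner ℂ v (A v) + inner ℂ u (P v) + inner ℂ u (Q u) -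
      (formShift ε P Q : ℂ) * inner ℂ u u)).re = -(z.re * r) + (z * inner ℂ u (P v)).re +
        (z * inner ℂ u (Q u)).re - z.re * (formShift ε P Q * ‖u‖ ^ 2) := by
    have e : z * (-inner ℂ v (A v) + inner ℂ u (P v) + inner ℂ u (Q u) -
        (formShift ε P Q : ℂ) * inner ℂ u u) = -(z * (r : ℂ)) + z * inner ℂ u (P v) +
          z * inner ℂ u (Q u) - z * ((formShift ε P Q * ‖u‖ ^ 2 : ℝ) : ℂ) := by
      rw [hr, inner_self_eq_norm_sq_to_K]
      push_cast
      simp only [Complex.coe_algebraMap]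
      ring
    rw [e, Complex.sub_re, Complex.add_re, Complex.add_re, Complex.neg_re, Complex.re_mul_ofReal,
      Complex.re_mul_ofReal]
  have h6 : 2 * (‖u‖ * (‖P‖ * ‖v‖)) ≤ ε / 2 * ‖v‖ ^ 2 + 2 * ‖P‖ ^ 2 / ε * ‖u‖ ^ 2 := by
    have e : ε / 2 * ‖v‖ ^ 2 + 2 * ‖P‖ ^ 2 / ε * ‖u‖ ^ 2 - 2 * (‖u‖ * (‖P‖ * ‖v‖)) =
        (ε * ‖v‖ - 2 * ‖P‖ * ‖u‖) ^ 2 / (2 * ε) := by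
      field_simp
      ring
    have : 0 ≤ (ε * ‖v‖ - 2 * ‖P‖ * ‖u‖) ^ 2 / (2 * ε) := by positivity
    linarith
  have h7 : 2 * (‖u‖ * ‖P v‖) + 2 * (‖u‖ * ‖Q u‖) - r - formShift ε P Q * ‖u‖ ^ 2 ≤
      -(ε / 2 * ‖v‖ ^ 2) := by
    unfold formShift
    nlinarith
  rw [h5]
  have h8 := mul_le_mul_of_nonneg_left h7 hz0
  nlinarith

/-- Lax–Milgram: the form on `V` is represented by a bounded operator, coercive with constant `min
(ε / 2) μ`, hence invertible. In the application `V` is `H¹_lam` and `π₁`, `π₂` send `u` to `u` and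
`u'`. -/
theorem exists_weak_solution [CompleteSpace H] {V : Type*} [NormedAddCommGroup V]
    [InnerProductSpace ℂ V]
    [CompleteSpace V] (π₁ π₂ : V →L[ℂ] H) (hπ : ∀ p, ‖p‖ ^ 2 = ‖π₁ p‖ ^ 2 + ‖π₂ p‖ ^ 2)
    {ε : ℝ} (hε : 0 < ε) {A : H →L[ℂ] H}
    (hA : ∀ v, ∃ r : ℝ, inner ℂ v (A v) = r ∧ ε * ‖v‖ ^ 2 ≤ r) (P Q : H →L[ℂ] H) {μ : ℝ}
    (hμ : 0 < μ) (f : H) :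
    ∃ p : V, ∀ q : V, inner ℂ (π₂ q) (A (π₂ p)) - inner ℂ (π₁ q) (P (π₂ p)) -
      inner ℂ (π₁ q) (Q (π₁ p)) + ((formShift ε P Q + μ : ℝ) : ℂ) * inner ℂ (π₁ q) (π₁ p) =
        inner ℂ (π₁ q) f := by
  let T : V →L[ℂ] V := π₂.adjoint ∘L A ∘L π₂ - π₁.adjoint ∘L P ∘L π₂ - π₁.adjoint ∘L Q ∘L π₁ +
    ((formShift ε P Q + μ : ℝ) : ℂ) • (π₁.adjoint ∘L π₁)
  have hT : ∀ p q, inner ℂ q (T p) = inner ℂ (π₂ q) (A (π₂ p)) - inner ℂ (π₁ q) (P (π₂ p)) -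
      inner ℂ (π₁ q) (Q (π₁ p)) +
        ((formShift ε P Q + μ : ℝ) : ℂ) * inner ℂ (π₁ q) (π₁ p) := by
    intro p q
    simp only [T, _root_.add_apply, _root_.sub_apply, _root_.smul_apply,
      ContinuousLinearMap.comp_apply, inner_add_right, inner_sub_right, inner_smul_right,
      ContinuousLinearMap.adjoint_inner_right]
  have hc : 0 < min (ε / 2) μ := lt_min (by linarith) hμ
  have hunit : IsUnit T := by
    refine T.isUnit_of_forall_le_norm_inner_map (c := (min (ε / 2) μ).toNNReal)
      (Real.toNNReal_pos.2 hc) fun p => ?_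
    rw [norm_inner_symm]
    refine le_trans ?_ (Complex.re_le_norm _)
    have h1 := re_mul_form_le hε hA P Q (z := 1) (by simp [closedCone]) (π₁ p) (π₂ p)
    have h2 : inner ℂ p (T p) = -(1 * (-inner ℂ (π₂ p) (A (π₂ p)) + inner ℂ (π₁ p) (P (π₂ p)) +
        inner ℂ (π₁ p) (Q (π₁ p)) - (formShift ε P Q : ℂ) * inner ℂ (π₁ p) (π₁ p))) +
        ((μ * ‖π₁ p‖ ^ 2 : ℝ) : ℂ) := by
      rw [hT, inner_self_eq_norm_sq_to_K (π₁ p)]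
      push_cast
      simp only [Complex.coe_algebraMap]
      ring
    rw [h2, Complex.add_re, Complex.neg_re, Complex.ofReal_re, hπ, Real.coe_toNNReal _ hc.le]
    rw [Complex.one_re] at h1
    have h3 := mul_le_mul_of_nonneg_right (min_le_left (ε / 2) μ) (sq_nonneg ‖π₂ p‖)
    have h4 := mul_le_mul_of_nonneg_right (min_le_right (ε / 2) μ) (sq_nonneg ‖π₁ p‖)
    nlinarith
  obtain ⟨S, hS⟩ := hunit.exists_right_inv
  refine ⟨S (π₁.adjoint f), fun q => ?_⟩
  rw [← hT]
  have : T (S (π₁.adjoint f)) = π₁.adjoint f := congrArg (fun B : V →L[ℂ] V => B _) hS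
  rw [this, ContinuousLinearMap.adjoint_inner_right]

end Form

/-! ### Test functions as elements of the weighted space -/

theorem exists_testVec (lam : ℝ) {g : ℝ → ℝ} (hg : Continuous g) (hc : HasCompactSupport g) :
    ∃ G : WeightedL2 lam, G =ᵐ[volume] fun x => (g x : ℂ) := by
  have h : MemLp (fun x => (g x : ℂ)) 2 (weightMeasure lam) :=
    (Complex.continuous_ofReal.comp hg).memLp_of_hasCompactSupport
      (hc.comp_left (g := fun x : ℝ => (x : ℂ)) Complex.ofReal_zero)
  exact ⟨h.toLp, ae_weightMeasure_iff.1 h.coeFn_toLp⟩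

theorem inner_testVec {lam : ℝ} {g : ℝ → ℝ} {G : WeightedL2 lam}
    (hG : G =ᵐ[volume] fun x => (g x : ℂ)) (u : WeightedL2 lam) :
    inner ℂ G u = ∫ x, (g x * weight lam x) • u x := by
  rw [inner_eq_integral_pairing]
  refine integral_congr_ae ?_
  filter_upwards [hG] with x hx
  simp only [pairing, hx, Complex.conj_ofReal, Complex.real_smul]
  push_cast
  ring

theorem isWeakDeriv_testVec {lam : ℝ} {ψ : ℝ → ℝ} (hψ : ContDiff ℝ ∞ ψ)
    {G G' : WeightedL2 lam} (hG : G =ᵐ[volume] fun x => (ψ x : ℂ))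
    (hG' : G' =ᵐ[volume] fun x => ((deriv ψ x : ℝ) : ℂ)) : IsWeakDeriv G G' := by
  intro φ hφ hc
  have hφ' : Continuous (deriv φ) := hφ.continuous_deriv (by simp)
  have hψ' : Continuous (deriv ψ) := hψ.continuous_deriv (by simp)
  have h := integral_mul_deriv_eq_deriv_mul_of_integrable (u := ψ) (v := φ)
    (fun x _ => (hψ.differentiable (by simp) x).hasDerivAt)
    (fun x _ => (hφ.differentiable (by simp) x).hasDerivAt)
    ((hψ.continuous.mul hφ').integrable_of_hasCompactSupport hc.deriv.mul_left)
    ((hψ'.mul hφ.continuous).integrable_of_hasCompactSupport hc.mul_left)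
    ((hψ.continuous.mul hφ.continuous).integrable_of_hasCompactSupport hc.mul_left)
  have e1 : ∫ x, deriv φ x • G x = ((∫ x, ψ x * deriv φ x : ℝ) : ℂ) := by
    rw [← integral_complex_ofReal]
    refine integral_congr_ae ?_
    filter_upwards [hG] with x hx
    rw [hx, Complex.real_smul]
    push_cast
    ring
  have e2 : ∫ x, φ x • G' x = ((∫ x, deriv ψ x * φ x : ℝ) : ℂ) := by
    rw [← integral_complex_ofReal]
    refine integral_congr_ae ?_
    filter_upwards [hG'] with x hx
    rw [hx, Complex.real_smul]
    push_cast
    ring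
  rw [e1, e2, h, Complex.ofReal_neg]

/-- The functional is the inner product with `g / w`, which is again continuous with compact
support. Consequently weak differentiability is a closed condition and `H¹_lam` is complete. -/
theorem continuous_integral_smul (lam : ℝ) {g : ℝ → ℝ} (hg : Continuous g)
    (hc : HasCompactSupport g) : Continuous fun u : WeightedL2 lam => ∫ x, g x • u x := by
  obtain ⟨G, hG⟩ := exists_testVec lam (g := fun x => g x * (weight lam x)⁻¹)
    (hg.mul ((contDiff_weight lam).continuous.inv₀ fun x => (weight_pos lam x).ne')) hc.mul_right
  have e : (fun u : WeightedL2 lam => ∫ x, g x • u x) = fun u => inner ℂ G u := by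
    ext u
    rw [inner_testVec hG]
    simp only [mul_assoc, inv_mul_cancel₀ (weight_pos lam _).ne', mul_one]
  rw [e]
  fun_prop

/-- The weighted Sobolev space `H¹_lam(ℝ)`, as the graph of the weak derivative. -/
def weightedH1 (lam : ℝ) : Submodule ℂ (WithLp 2 (WeightedL2 lam × WeightedL2 lam)) where
  carrier := {p | IsWeakDeriv p.fst p.snd}
  zero_mem' := isWeakDeriv_zero lam
  add_mem' := IsWeakDeriv.add
  smul_mem' k _ h := IsWeakDeriv.smul k h

theorem isClosed_weightedH1 (lam : ℝ) :
    IsClosed (weightedH1 lam : Set (WithLp 2 (WeightedL2 lam × WeightedL2 lam))) := by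
  have e : (weightedH1 lam : Set (WithLp 2 (WeightedL2 lam × WeightedL2 lam))) =
      ⋂ (φ : ℝ → ℝ) (_ : ContDiff ℝ ∞ φ) (_ : HasCompactSupport φ),
        {p | ∫ x, deriv φ x • p.fst x = - ∫ x, φ x • p.snd x} := by
    ext p
    simp only [mem_iInter]
    rfl
  rw [e]
  refine isClosed_iInter fun φ => isClosed_iInter fun hφ => isClosed_iInter fun hc => ?_
  have c1 := continuous_integral_smul lam (hφ.continuous_deriv (by simp)) hc.deriv
  have c2 := continuous_integral_smul lam hφ.continuous hc
  exact isClosed_eq (c1.comp (WithLp.continuous_fst 2 _ _))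
    (c2.comp (WithLp.continuous_snd 2 _ _)).neg

instance (lam : ℝ) : CompleteSpace (weightedH1 lam) :=
  (isClosed_weightedH1 lam).completeSpace_coe

/-! ### The elliptic operator -/

theorem isBoundedContinuous_div_sqrt : IsBoundedContinuous fun x : ℝ => x / √(1 + x ^ 2) := by
  have hpos : ∀ x : ℝ, 0 < √(1 + x ^ 2) := fun x => Real.sqrt_pos.2 (by positivity)
  refine ⟨Continuous.div₀ continuous_id (by fun_prop) fun x => (hpos x).ne', 1, fun x => ?_⟩
  rw [abs_div, abs_of_pos (hpos x), div_le_one (hpos x)]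
  exact Real.abs_le_sqrt (by linarith)

/-- The logarithmic drift `(a w)' / w` of the weighted second order term. -/
noncomputable def drift (lam : ℝ) (a : ℝ → ℝ) (x : ℝ) : ℝ :=
  deriv a x + a x * (-2 * lam * (x / √(1 + x ^ 2)))

theorem isBoundedContinuous_drift (lam : ℝ) {a : ℝ → ℝ} (ha : IsTotallyBounded a) :
    IsBoundedContinuous (drift lam a) :=
  ha.deriv.add (ha.isBoundedContinuous.mul
    ((IsBoundedContinuous.const (-2 * lam)).mul isBoundedContinuous_div_sqrt))

theorem deriv_mul_weight (lam : ℝ) {a : ℝ → ℝ} (ha : ContDiff ℝ ∞ a) (x : ℝ) :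
    deriv (fun x => a x * weight lam x) x = drift lam a x * weight lam x := by
  rw [((ha.differentiable (by simp) x).hasDerivAt.fun_mul (hasDerivAt_weight lam x)).deriv, drift]
  ring

variable {lam : ℝ} {a b c : ℝ → ℝ}

theorem inner_mulCLM_add_eq_zero {p p' q q' : WeightedL2 lam} (hp : IsWeakDeriv p p')
    (hq : IsWeakDeriv q q') (ha : IsTotallyBounded a) :
    inner ℂ p ((isBoundedContinuous_drift lam ha).mulCLM lam q) +
      inner ℂ p (ha.isBoundedContinuous.mulCLM lam q') +
      inner ℂ p' (ha.isBoundedContinuous.mulCLM lam q) = 0 := by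
  have he := isBoundedContinuous_drift lam ha
  have ha' := ha.isBoundedContinuous
  have i1 := he.integrable_smul (integrable_pairing p q)
  have i2 := ha'.integrable_smul (integrable_pairing p q')
  have i3 := ha'.integrable_smul (integrable_pairing p' q)
  rw [he.inner_mulCLM, ha'.inner_mulCLM, ha'.inner_mulCLM, ← integral_add i1 i2]
  refine (integral_add (i1.add i2) i3).symm.trans ?_
  exact integral_pairing_eq_zero hp hq ha.contDiff ha' he (deriv_mul_weight lam ha.contDiff)

/-- The first order coefficient of the form associated with the elliptic operator. -/
noncomputable def formFirstOrder (lam : ℝ) (ha : IsTotallyBounded a) (hb : IsTotallyBounded b) :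
    WeightedL2 lam →L[ℂ] WeightedL2 lam :=
  hb.isBoundedContinuous.mulCLM lam - (isBoundedContinuous_drift lam ha).mulCLM lam

/-- The form of the elliptic operator. -/
theorem inner_elliptic {u u' u'' v v' : WeightedL2 lam} (hv : IsWeakDeriv v v')
    (hu' : IsWeakDeriv u' u'') (ha : IsTotallyBounded a) (hb : IsTotallyBounded b)
    (hc : IsTotallyBounded c) :
    inner ℂ v (mulOp ha lam u'' + mulOp hb lam u' + mulOp hc lam u) =
      -inner ℂ v' (ha.isBoundedContinuous.mulCLM lam u') +
        inner ℂ v (formFirstOrder lam ha hb u') +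
        inner ℂ v (hc.isBoundedContinuous.mulCLM lam u) := by
  have h := inner_mulCLM_add_eq_zero hv hu' ha
  rw [ha.mulOp_eq, hb.mulOp_eq, hc.mulOp_eq, inner_add_right, inner_add_right, formFirstOrder,
    _root_.sub_apply, inner_sub_right]
  linear_combination h

theorem exists_inner_mulCLM_self (ha : IsTotallyBounded a) {ε : ℝ} (h : ∀ x, ε ≤ a x)
    (v : WeightedL2 lam) :
    ∃ r : ℝ, inner ℂ v (ha.isBoundedContinuous.mulCLM lam v) = r ∧ ε * ‖v‖ ^ 2 ≤ r :=
  ⟨_, ha.isBoundedContinuous.inner_mulCLM_self v,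
    ha.isBoundedContinuous.le_inner_mulCLM_self h v⟩

/-- Elliptic regularity: if `(a w u')' = w g` in the sense of distributions, then `u'` is weakly
differentiable and `a u'' + (drift) u' = g`. -/
theorem exists_isWeakDeriv_of_weak (ha : IsTotallyBounded a) {ε : ℝ} (hε : 0 < ε)
    (h : ∀ x, ε ≤ a x) {u' g : WeightedL2 lam}
    (hu : ∀ ψ ψ' : WeightedL2 lam, IsWeakDeriv ψ ψ' →
      inner ℂ ψ' (ha.isBoundedContinuous.mulCLM lam u') +
        inner ℂ ψ ((isBoundedContinuous_drift lam ha).mulCLM lam u') = -inner ℂ ψ g) :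
    ∃ u'', IsWeakDeriv u' u'' ∧ ha.isBoundedContinuous.mulCLM lam u'' = g := by
  have ha' := ha.isBoundedContinuous
  have he' := isBoundedContinuous_drift lam ha
  have hi := ha'.inv hε h
  have hm : ContDiff ℝ ∞ fun x => a x * weight lam x := ha.contDiff.mul (contDiff_weight lam)
  have hm0 : ∀ x, a x * weight lam x ≠ 0 := fun x =>
    mul_ne_zero (hε.trans_le (h x)).ne' (weight_pos lam x).ne'
  -- For a real test function `ψ`, the left side of `hu` is `∫ (ψ a w)' u'`, so `hu` says that `a
  -- u'' = g` weakly; the candidate is `g / a`. Any test function `φ` is reached by taking `ψ = φ /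
  -- (a w)`.
  refine ⟨hi.mulCLM lam g, fun φ hφ hc => ?_, ?_⟩
  · set ψ : ℝ → ℝ := fun x => φ x * (a x * weight lam x)⁻¹ with hψdef
    have hψ : ContDiff ℝ ∞ ψ := hφ.mul (hm.inv hm0)
    have hψc : HasCompactSupport ψ := hc.mul_right
    have hφψ : φ = fun x => ψ x * (a x * weight lam x) := by
      ext x
      simp only [hψdef, mul_assoc, inv_mul_cancel₀ (hm0 x), mul_one]
    have hφ' : ∀ x, deriv φ x =
        deriv ψ x * (a x * weight lam x) + ψ x * (drift lam a x * weight lam x) := by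
      intro x
      rw [← deriv_mul_weight lam ha.contDiff, ← deriv_fun_mul (hψ.differentiable (by simp) x)
        (hm.differentiable (by simp) x), ← hφψ]
    have hψ' : Continuous (deriv ψ) := hψ.continuous_deriv (by simp)
    obtain ⟨G, hG⟩ := exists_testVec lam hψ.continuous hψc
    obtain ⟨G', hG'⟩ := exists_testVec lam hψ' hψc.deriv
    have key := hu G G' (isWeakDeriv_testVec hψ hG hG')
    rw [inner_testVec hG, inner_testVec hG, inner_testVec hG'] at key
    have lu := locallyIntegrable_weightedL2 (ha'.mulCLM lam u')
    have lu2 := locallyIntegrable_weightedL2 (he'.mulCLM lam u')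
    have hw := (contDiff_weight lam).continuous
    have i1 : Integrable fun x => (deriv ψ x * weight lam x) • ha'.mulCLM lam u' x :=
      lu.integrable_smul_left_of_hasCompactSupport (hψ'.mul hw) hψc.deriv.mul_right
    have i2 : Integrable fun x => (ψ x * weight lam x) • he'.mulCLM lam u' x :=
      lu2.integrable_smul_left_of_hasCompactSupport (hψ.continuous.mul hw) hψc.mul_right
    rw [← integral_add i1 i2] at key
    have e1 : ∫ x, deriv φ x • u' x = ∫ x, ((deriv ψ x * weight lam x) • ha'.mulCLM lam u' x +
        (ψ x * weight lam x) • he'.mulCLM lam u' x) := by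
      refine integral_congr_ae ?_
      filter_upwards [ha'.coeFn_mulCLM u', he'.coeFn_mulCLM u'] with x h1 h2
      rw [h1, h2, hφ']
      simp only [Complex.real_smul]
      push_cast
      ring
    have e2 : ∫ x, φ x • hi.mulCLM lam g x = ∫ x, (ψ x * weight lam x) • g x := by
      refine integral_congr_ae ?_
      filter_upwards [hi.coeFn_mulCLM g] with x h1
      have h2 : (a x : ℂ) ≠ 0 := by exact_mod_cast (hε.trans_le (h x)).ne'
      have h3 : φ x = ψ x * (a x * weight lam x) := congrFun hφψ x
      rw [h1, h3]
      simp only [Complex.real_smul]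
      push_cast
      field_simp
    rw [e1, e2, key]
  · refine Lp.ext (ae_weightMeasure_iff.2 ?_)
    filter_upwards [ha'.coeFn_mulCLM (hi.mulCLM lam g), hi.coeFn_mulCLM g] with x h1 h2
    rw [h1, h2, smul_smul, mul_inv_cancel₀ (hε.trans_le (h x)).ne', one_smul]

/-- The range condition for the elliptic operator. -/
theorem exists_elliptic_solution (ha : IsTotallyBounded a) (hb : IsTotallyBounded b)
    (hc : IsTotallyBounded c) {ε : ℝ} (hε : 0 < ε) (h : ∀ x, ε ≤ a x) {μ : ℝ} (hμ : 0 < μ)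
    (f : WeightedL2 lam) :
    ∃ u u' u'' : WeightedL2 lam, IsWeakDeriv u u' ∧ IsWeakDeriv u' u'' ∧
      mulOp ha lam u'' + mulOp hb lam u' + mulOp hc lam u =
        ((formShift ε (formFirstOrder lam ha hb) (hc.isBoundedContinuous.mulCLM lam) + μ : ℝ) :
          ℂ) • u - f := by
  obtain ⟨p, hp⟩ := exists_weak_solution (V := weightedH1 lam)
    (WithLp.fstL 2 ℂ _ _ ∘L (weightedH1 lam).subtypeL)
    (WithLp.sndL 2 ℂ _ _ ∘L (weightedH1 lam).subtypeL)
    (fun p => WithLp.prod_norm_sq_eq_of_L2 (p : WithLp 2 (WeightedL2 lam × WeightedL2 lam)))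
    hε (exists_inner_mulCLM_self ha h) (formFirstOrder lam ha hb)
    (hc.isBoundedContinuous.mulCLM lam) hμ f
  obtain ⟨⟨u, u'⟩, hu⟩ := p
  set k : ℂ := ((formShift ε (formFirstOrder lam ha hb) (hc.isBoundedContinuous.mulCLM lam) + μ :
    ℝ) : ℂ)
  -- Here `g` is the value of `a u''` demanded by the equation. The drift term in the hypothesis
  -- comes from the drift subtracted in `formFirstOrder`.
  obtain ⟨u'', hu'', hau⟩ := exists_isWeakDeriv_of_weak (lam := lam) ha hε h (u' := u')
    (g := k • u - f - hb.isBoundedContinuous.mulCLM lam u' - hc.isBoundedContinuous.mulCLM lam u)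
    (by
      intro ψ ψ' hψ
      have h1 : inner ℂ ψ' (ha.isBoundedContinuous.mulCLM lam u') -
          inner ℂ ψ (formFirstOrder lam ha hb u') -
          inner ℂ ψ (hc.isBoundedContinuous.mulCLM lam u) + k * inner ℂ ψ u = inner ℂ ψ f :=
        hp ⟨WithLp.toLp 2 (ψ, ψ'), hψ⟩
      rw [formFirstOrder, _root_.sub_apply, inner_sub_right] at h1
      rw [inner_sub_right, inner_sub_right, inner_sub_right, inner_smul_right]
      linear_combination h1)
  refine ⟨u, u', u'', hu, hu'', ?_⟩
  rw [ha.mulOp_eq, hb.mulOp_eq, hc.mulOp_eq, hau]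
  abel

theorem generatesAnalyticSemigroup_ellipticOp (ha : IsTotallyBounded a) (hb : IsTotallyBounded b)
    (hc : IsTotallyBounded c) (h : IsUniformlyStronglyElliptic a b c) :
    GeneratesAnalyticSemigroup (ellipticOp lam ha hb hc) := by
  obtain ⟨ε, hε, hell⟩ := h.elliptic
  set κ : ℝ := formShift ε (formFirstOrder lam ha hb) (hc.isBoundedContinuous.mulCLM lam) with hκ
  -- The graph of `T - κ`, as the preimage of the graph of `T` under `(x, y) ↦ (x, y + κ x)`.
  let G : Submodule ℂ (WeightedL2 lam × WeightedL2 lam) := (ellipticOp lam ha hb hc).graph.comap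
    (LinearMap.prod (LinearMap.fst ℂ _ _)
      (LinearMap.snd ℂ _ _ + (κ : ℂ) • LinearMap.fst ℂ (WeightedL2 lam) (WeightedL2 lam)))
  have hG : ∀ x y, (x, y) ∈ G ↔ (x, y + (κ : ℂ) • x) ∈ (ellipticOp lam ha hb hc).graph :=
    fun x y => Iff.rfl
  refine generatesAnalyticSemigroup_of_shift (G := G) ⟨?_, ?_, ?_⟩ κ fun x y => ?_
  · rintro ⟨x, y⟩ hxy z hz
    obtain ⟨x', x'', hx, hx', hy⟩ := (mem_graph_ellipticOp lam ha hb hc _ _).1 ((hG x y).1 hxy)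
    have h1 := inner_elliptic (u := x) hx hx' ha hb hc
    rw [← hy, inner_add_right, inner_smul_right, ← eq_sub_iff_add_eq] at h1
    have h2 := re_mul_form_le hε (exists_inner_mulCLM_self (lam := lam) ha hell)
      (formFirstOrder lam ha hb) (hc.isBoundedContinuous.mulCLM lam) hz x x'
    have hz0 : 0 ≤ z.re := (abs_nonneg _).trans hz
    rw [h1]
    refine h2.trans ?_
    rw [neg_nonpos]
    positivity
  · intro μ hμ f
    obtain ⟨u, u', u'', hu, hu', he⟩ := exists_elliptic_solution (lam := lam) ha hb hc hε hell hμ f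
    refine ⟨u, (hG _ _).2 ((mem_graph_ellipticOp lam ha hb hc _ _).2 ⟨u', u'', hu, hu', ?_⟩)⟩
    rw [he, ← hκ]
    push_cast
    module
  · intro y hy
    have := (hG 0 y).1 hy
    rw [smul_zero, add_zero] at this
    exact LinearPMap.graph_fst_eq_zero_snd _ this rfl
  · rw [hG, sub_add_cancel]

/-! ### The operator `∂ₓ² - ∂ₓ` -/

theorem isTotallyBounded_const (k : ℝ) : IsTotallyBounded fun _ => k :=
  ⟨contDiff_const, fun n => ⟨|k|, fun x => by
    rw [iteratedDeriv_const]
    split_ifs <;> simp⟩⟩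

theorem mulOp_const (k : ℝ) (u : WeightedL2 lam) :
    mulOp (isTotallyBounded_const k) lam u = (k : ℂ) • u := by
  refine Lp.ext ?_
  filter_upwards [((isTotallyBounded_const k).memLp u).coeFn_toLp, Lp.coeFn_smul (k : ℂ) u]
    with x h1 h2
  rw [h2, Pi.smul_apply, Complex.coe_smul, ← h1]
  rfl

theorem opB_eq_ellipticOp (lam : ℝ) :
    opB lam = ellipticOp lam (isTotallyBounded_const 1) (isTotallyBounded_const (-1))
      (isTotallyBounded_const 0) := by
  refine LinearPMap.eq_of_eq_graph ?_
  ext ⟨u, f⟩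
  rw [mem_graph_opB, mem_graph_ellipticOp]
  simp only [mulOp_const, Complex.ofReal_one, Complex.ofReal_neg, Complex.ofReal_zero, one_smul,
    neg_smul, zero_smul, add_zero, ← sub_eq_add_neg]

end WeightedSemigroup

theorem theorem3p9 (lam : ℝ) :
    (∀ (a b c : ℝ → ℝ) (ha : WeightedSemigroup.IsTotallyBounded a)
        (hb : WeightedSemigroup.IsTotallyBounded b) (hc : WeightedSemigroup.IsTotallyBounded c),
        WeightedSemigroup.IsUniformlyStronglyElliptic a b c →
          WeightedSemigroup.GeneratesAnalyticSemigroup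
            (WeightedSemigroup.ellipticOp lam ha hb hc)) ∧
      WeightedSemigroup.GeneratesAnalyticSemigroup (WeightedSemigroup.opB lam) := by
  refine ⟨fun a b c ha hb hc h =>
    WeightedSemigroup.generatesAnalyticSemigroup_ellipticOp ha hb hc h, ?_⟩
  rw [WeightedSemigroup.opB_eq_ellipticOp]
  exact WeightedSemigroup.generatesAnalyticSemigroup_ellipticOp _ _ _
    ⟨⟨1, by simp⟩, ⟨1, by simp⟩, ⟨0, by simp⟩, 1, one_pos, by simp⟩
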